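/- A \emph{vertex cover} of a graph is a set of vertices containing at least one end of each edge; it is \emph{minimum} if its cardinality is the smallest among all vertex covers of the graph. For $n\ge 1$ let $N_{vc}(n)$ be the total number of minimum vertex covers among all labeled trees on $n$ vertices, i.e. the sum, over the trees with vertex set $\{1,\dots,n\}$, of the number of minimum vertex covers of the tree. Put $F_{vc}(x)=\sum_{n\ge 1}\frac{N_{vc}(n)}{n!}x^n$ and $T(x)=\sum_{n\ge 1}\frac{n^{n-1}}{n!}x^n$, as formal power series over $\mathbb{Q}$. \textbf{Theorem.} There is exactly one formal power series $U=U(x)\in\mathbb{Q}[[x]]$ with zero constant term such that $$xUe^U=T(x^2e^{2U})\,(e^{xe^U}-1),$$ and with this $U$ $$F_{vc}(x)=(1-U)\,xe^U-U\,T(x^2e^{2U})+U-\tfrac12 U^2 .$$ Moreover $$(N_{vc}(1),\dots,N_{vc}(10))=(1,2,3,40,185,3936,35917,978160,14301513,464105440).$$ -/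

import Mathlib

open PowerSeries

namespace TreeVertexCovers

/-- `c` is a minimum vertex cover of `G`: a vertex cover whose cardinality is the smallest. -/
def IsMinVertexCover {V : Type*} (G : SimpleGraph V) (c : Set V) : Prop :=
  G.IsVertexCover c ∧ ∀ d : Set V, G.IsVertexCover d → c.encard ≤ d.encard

open Classical in
/-- The total number of minimum vertex covers among the labeled trees on `n` vertices. -/
noncomputable def numMinVertexCovers (n : ℕ) : ℕ :=
  ∑ G : SimpleGraph (Fin n) with G.IsTree, {c : Set (Fin n) | IsMinVertexCover G c}.ncard

/-- The exponential generating function `∑_{n ≥ 1} a n / n! * X ^ n` (without a term of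
degree `0`). -/
noncomputable def egf (a : ℕ → ℕ) : ℚ⟦X⟧ :=
  PowerSeries.mk fun n => if n = 0 then 0 else (a n : ℚ) / (n.factorial : ℚ)

/-- The tree generating function `T(x) = ∑_{n ≥ 1} n ^ (n - 1) / n! * x ^ n`. -/
noncomputable def treeSeries : ℚ⟦X⟧ := egf fun n => n ^ (n - 1)

/-- `F_vc(x)`, the exponential generating function of the total number of minimum vertex covers. -/
noncomputable def vcSeries : ℚ⟦X⟧ := egf numMinVertexCovers

/-- The composite `e ^ u`, for a power series `u` without constant term. -/
noncomputable def expOf (u : ℚ⟦X⟧) : ℚ⟦X⟧ := (PowerSeries.exp ℚ).subst u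

/-- The composite `T(u)`, for a power series `u` without constant term. -/
noncomputable def treeOf (u : ℚ⟦X⟧) : ℚ⟦X⟧ := treeSeries.subst u

/-- `U` is a formal power series without constant term that solves
`x U e^U = T(x^2 e^{2U}) (e^{x e^U} - 1)`. -/
def IsImplicitSolution (U : ℚ⟦X⟧) : Prop :=
  constantCoeff U = 0 ∧
    X * U * expOf U = treeOf (X ^ 2 * expOf (2 * U)) * (expOf (X * expOf U) - 1)

end TreeVertexCovers

/-! Root a tree with a vertex cover at a vertex. Relative to the root, the cover has one of four
kinds; write U, P, F, W for the exponential generating functions of tight, pending, free and used.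
Joining two rooted trees by an edge between their roots makes the smallest cover sizes combine by
explicit formulas (`coverNumAt_link`, `coverNum_link`), so the kind of the result depends only on
the two kinds (`holds_link_iff`).

Marking an edge at the root and cutting it turns counts into products of series
(`edgeRootedSeries_eq`). Repeating this over the root degree gives exponentials (`eq_mul_expOf`): F
= x e^U, P = x e^(U+W), P + U = x e^(U+F+W), while W = F P. Hence W = F^2 e^W, that is W = T(F^2),
and P + U = P e^F; multiplying the latter by F yields F U = W (e^F - 1), the implicit equation. Its
solution is unique because it can be written U = x Φ(U), so that the difference of two solutions is
annihilated by a unit.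

A tree has one more vertex than edges. Thus F_vc is the series of vertex-rooted trees with a minimum
cover minus that of edge-rooted ones (`two_mul_vcSeries`), both polynomial in U, P, F, W. The ten
values follow from coefficient recurrences for the same system. -/

namespace TreeVertexCovers

open SimpleGraph

/-! ### Joining two graphs by an edge -/

section Link

variable {V W : Type*}

/-- The disjoint union of `G` and `H` together with an edge from `v` to `w`. -/
def link (G : SimpleGraph V) (H : SimpleGraph W) (v : V) (w : W) : SimpleGraph (V ⊕ W) :=
  (G ⊕g H) ⊔ SimpleGraph.edge (Sum.inl v) (Sum.inr w)

variable {G : SimpleGraph V} {H : SimpleGraph W} {v : V} {w : W}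

@[simp] lemma link_adj_inl_inl {a b : V} :
    (link G H v w).Adj (.inl a) (.inl b) ↔ G.Adj a b := by
  simp [link, SimpleGraph.edge_adj]

@[simp] lemma link_adj_inr_inr {a b : W} :
    (link G H v w).Adj (.inr a) (.inr b) ↔ H.Adj a b := by
  simp [link, SimpleGraph.edge_adj]

@[simp] lemma link_adj_inl_inr {a : V} {b : W} :
    (link G H v w).Adj (.inl a) (.inr b) ↔ a = v ∧ b = w := by
  simp [link, SimpleGraph.edge_adj]

@[simp] lemma link_adj_inr_inl {a : V} {b : W} :
    (link G H v w).Adj (.inr b) (.inl a) ↔ a = v ∧ b = w := by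
  rw [SimpleGraph.adj_comm, link_adj_inl_inr]

lemma link_swap : (link G H v w).comap (Sum.swap : W ⊕ V → V ⊕ W) = link H G w v := by
  ext (a | a) (b | b) <;> simp [and_comm]

/-- Collapsing the side of `w` to the vertex `v` sends every edge of the linked graph to an edge of
`G` or to a single vertex. -/
lemma reachable_of_reachable_link {a : V} {x : V ⊕ W}
    (h : (link G H v w).Reachable (.inl a) x) :
    G.Reachable a (Sum.elim id (fun _ => v) x) := by
  rw [SimpleGraph.reachable_iff_reflTransGen] at h
  induction h with
  | refl => exact Reachable.refl _
  | tail _ hadj ih =>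
    rename_i y z _
    refine ih.trans ?_
    rcases y with y | y <;> rcases z with z | z
    · exact (link_adj_inl_inl.1 hadj).reachable
    · obtain ⟨rfl, -⟩ := link_adj_inl_inr.1 hadj
      exact Reachable.refl _
    · obtain ⟨rfl, -⟩ := link_adj_inr_inl.1 hadj
      exact Reachable.refl _
    · exact Reachable.refl _

lemma isTree_of_isTree_link (h : (link G H v w).IsTree) : G.IsTree where
  isAcyclic := h.isAcyclic.comap ⟨Sum.inl, fun hab => link_adj_inl_inl.2 hab⟩ Sum.inl_injective
  connected :=
    { preconnected := fun a b => reachable_of_reachable_link (h.connected.preconnected (.inl a) (.inl b))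
      nonempty := ⟨v⟩ }

lemma card_edgeSet_link [Finite V] [Finite W] :
    Nat.card (link G H v w).edgeSet = Nat.card G.edgeSet + Nat.card H.edgeSet + 1 := by
  have hne : (Sum.inl v : V ⊕ W) ≠ Sum.inr w := Sum.inl_ne_inr
  rw [link, SimpleGraph.edgeSet_sup, SimpleGraph.edgeSet_edge_of_ne hne, Set.union_singleton, Nat.card_coe_set_eq,
    Set.ncard_insert_of_notMem (by simp), ← Nat.card_coe_set_eq,
    Nat.card_congr SimpleGraph.edgeSetSumEquiv, Nat.card_sum]

lemma isTree_link_iff [Finite V] [Finite W] :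
    (link G H v w).IsTree ↔ G.IsTree ∧ H.IsTree := by
  refine ⟨fun h => ⟨isTree_of_isTree_link h, ?_⟩, fun ⟨hG, hH⟩ => ?_⟩
  -- The second side becomes the first one after exchanging the summands.
  · refine isTree_of_isTree_link (H := G) (v := w) (w := v) ?_
    rw [← link_swap]
    let e : (link G H v w).comap (Sum.swap : W ⊕ V → V ⊕ W) ≃g link G H v w :=
      ⟨Equiv.sumComm W V, Iff.rfl⟩
    exact e.isTree_iff.2 h
  · have h1 := (isTree_iff_connected_and_card.1 hG).2
    have h2 := (isTree_iff_connected_and_card.1 hH).2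
    refine isTree_iff_connected_and_card.2 ⟨hG.connected.sum_sup_edge hH.connected, ?_⟩
    rw [card_edgeSet_link, Nat.card_sum]
    omega

/-- The side of a vertex is recovered from a linked graph by deleting the linking edge. -/
lemma reachable_deleteEdges_link (hG : G.Connected) {x : V ⊕ W} :
    ((link G H v w).deleteEdges {s(.inl v, .inr w)}).Reachable (.inl v) x ↔ x.isLeft := by
  constructor
  · intro h
    rw [SimpleGraph.reachable_iff_reflTransGen] at h
    induction h with
    | refl => rfl
    | tail _ hadj ih =>
      rename_i y z _
      rcases y with y | y <;> rcases z with z | z <;>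
        simp_all [SimpleGraph.deleteEdges_adj]
      tauto
  · rcases x with a | a
    · intro _
      let f : G →g (link G H v w).deleteEdges {s(.inl v, .inr w)} :=
        ⟨Sum.inl, fun hab => by simpa [SimpleGraph.deleteEdges_adj] using hab⟩
      exact (hG.preconnected v a).map f
    · simp

lemma neighborSet_link_inl : (link G H v w).neighborSet (.inl v) =
    insert (.inr w) (Sum.inl '' G.neighborSet v) := by
  ext (a | a) <;> simp

lemma ncard_neighborSet_link [Finite V] : ((link G H v w).neighborSet (.inl v)).ncard =
    (G.neighborSet v).ncard + 1 := by
  rw [neighborSet_link_inl, Set.ncard_insert_of_notMem (by simp),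
    Set.ncard_image_of_injective _ Sum.inl_injective]

lemma isVertexCover_link_iff {c : Set (V ⊕ W)} : (link G H v w).IsVertexCover c ↔
    G.IsVertexCover (Sum.inl ⁻¹' c) ∧ H.IsVertexCover (Sum.inr ⁻¹' c) ∧
      (Sum.inl v ∈ c ∨ Sum.inr w ∈ c) := by
  constructor
  · intro h
    exact ⟨fun a b hab => h (link_adj_inl_inl.2 hab), fun a b hab => h (link_adj_inr_inr.2 hab),
      h (link_adj_inl_inr.2 ⟨rfl, rfl⟩)⟩
  · rintro ⟨h1, h2, h3⟩ (a | a) (b | b) hab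
    · exact h1 (link_adj_inl_inl.1 hab)
    · obtain ⟨rfl, rfl⟩ := link_adj_inl_inr.1 hab
      exact h3
    · obtain ⟨rfl, rfl⟩ := link_adj_inr_inl.1 hab
      exact h3.symm
    · exact h2 (link_adj_inr_inr.1 hab)

lemma ncard_sum [Finite V] [Finite W] (c : Set (V ⊕ W)) :
    c.ncard = (Sum.inl ⁻¹' c : Set V).ncard + (Sum.inr ⁻¹' c : Set W).ncard := by
  conv_lhs => rw [← Set.image_preimage_inl_union_image_preimage_inr c]
  rw [Set.ncard_union_eq, Set.ncard_image_of_injective _ Sum.inl_injective,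
    Set.ncard_image_of_injective _ Sum.inr_injective]
  exact Set.disjoint_image_inl_image_inr

end Link

/-! ### Cover numbers -/

section CoverNumbers

variable {V W : Type*}

/-- The smallest cardinality of a vertex cover. -/
noncomputable def coverNum (G : SimpleGraph V) : ℕ :=
  sInf {n | ∃ d : Set V, G.IsVertexCover d ∧ d.ncard = n}

/-- The smallest cardinality of a vertex cover containing the vertex `r`. -/
noncomputable def coverNumAt (G : SimpleGraph V) (r : V) : ℕ :=
  sInf {n | ∃ d : Set V, G.IsVertexCover d ∧ r ∈ d ∧ d.ncard = n}

lemma coverNum_le {G : SimpleGraph V} {d : Set V} (hd : G.IsVertexCover d) :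
    coverNum G ≤ d.ncard := Nat.sInf_le ⟨d, hd, rfl⟩

lemma coverNumAt_le {G : SimpleGraph V} {r : V} {d : Set V} (hd : G.IsVertexCover d)
    (hr : r ∈ d) : coverNumAt G r ≤ d.ncard := Nat.sInf_le ⟨d, hd, hr, rfl⟩

lemma exists_ncard_eq_coverNum (G : SimpleGraph V) :
    ∃ d : Set V, G.IsVertexCover d ∧ d.ncard = coverNum G :=
  Nat.sInf_mem (s := {n | ∃ d : Set V, G.IsVertexCover d ∧ d.ncard = n})
    ⟨_, Set.univ, by simp, rfl⟩

lemma exists_ncard_eq_coverNumAt (G : SimpleGraph V) (r : V) :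
    ∃ d : Set V, G.IsVertexCover d ∧ r ∈ d ∧ d.ncard = coverNumAt G r :=
  Nat.sInf_mem (s := {n | ∃ d : Set V, G.IsVertexCover d ∧ r ∈ d ∧ d.ncard = n})
    ⟨_, Set.univ, by simp, by simp, rfl⟩

lemma coverNum_le_coverNumAt (G : SimpleGraph V) (r : V) : coverNum G ≤ coverNumAt G r := by
  obtain ⟨d, hd, -, h⟩ := exists_ncard_eq_coverNumAt G r
  exact h ▸ coverNum_le hd

/-- Adding the root to a smallest cover costs at most one vertex. Hence the two cover numbers are
equal or differ by one, the dichotomy behind the four kinds. -/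
lemma coverNumAt_le_succ (G : SimpleGraph V) (r : V) :
    coverNumAt G r ≤ coverNum G + 1 := by
  obtain ⟨d, hd, h⟩ := exists_ncard_eq_coverNum G
  rw [← h]
  exact (coverNumAt_le (hd.subset (Set.subset_insert r d)) (Set.mem_insert r d)).trans
    (Set.ncard_insert_le r d)

lemma isMinVertexCover_iff [Finite V] {G : SimpleGraph V} {c : Set V} :
    IsMinVertexCover G c ↔ G.IsVertexCover c ∧ c.ncard = coverNum G := by
  refine and_congr_right fun hc => ⟨fun h => ?_, fun h d hd => ?_⟩
  · obtain ⟨d, hd, hd'⟩ := exists_ncard_eq_coverNum G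
    refine le_antisymm ?_ (coverNum_le hc)
    have := h d hd
    rwa [← c.toFinite.cast_ncard_eq, ← d.toFinite.cast_ncard_eq, Nat.cast_le, hd'] at this
  · rw [← c.toFinite.cast_ncard_eq, ← d.toFinite.cast_ncard_eq, Nat.cast_le, h]
    exact coverNum_le hd

variable [Finite V] [Finite W] {G : SimpleGraph V} {H : SimpleGraph W} {v : V} {w : W}

/-- The union of a set of vertices on either side. -/
def sumSet (c : Set V) (d : Set W) : Set (V ⊕ W) := Sum.inl '' c ∪ Sum.inr '' d

omit [Finite V] [Finite W] in
@[simp] lemma preimage_inl_sumSet (c : Set V) (d : Set W) : Sum.inl ⁻¹' sumSet c d = c := by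
  ext; simp [sumSet]

omit [Finite V] [Finite W] in
@[simp] lemma preimage_inr_sumSet (c : Set V) (d : Set W) : Sum.inr ⁻¹' sumSet c d = d := by
  ext; simp [sumSet]

/-- Once `v` is in the cover, the linking edge imposes nothing on the other side, and the two sides
are optimized independently. -/
lemma coverNumAt_link : coverNumAt (link G H v w) (.inl v) = coverNumAt G v + coverNum H := by
  apply le_antisymm
  · obtain ⟨c, hc, hv, h1⟩ := exists_ncard_eq_coverNumAt G v
    obtain ⟨d, hd, h2⟩ := exists_ncard_eq_coverNum H
    have := coverNumAt_le (G := link G H v w) (r := .inl v) (d := sumSet c d)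
      (isVertexCover_link_iff.2 (⟨by simpa, by simpa, by simp [sumSet, hv]⟩)) (by simpa [sumSet])
    rwa [ncard_sum, preimage_inl_sumSet, preimage_inr_sumSet, h1, h2] at this
  · obtain ⟨c, hc, hv, h1⟩ := exists_ncard_eq_coverNumAt (link G H v w) (.inl v)
    rw [isVertexCover_link_iff] at hc
    rw [← h1, ncard_sum]
    exact add_le_add (coverNumAt_le hc.1 hv) (coverNum_le hc.2.1)

/-- The two terms correspond to covering the linking edge by `v` or by `w`. -/
lemma coverNum_link : coverNum (link G H v w) =
    min (coverNumAt G v + coverNum H) (coverNum G + coverNumAt H w) := by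
  apply le_antisymm
  · refine le_min (coverNumAt_link (G := G) (H := H) (w := w) ▸ coverNum_le_coverNumAt _ _) ?_
    obtain ⟨c, hc, h1⟩ := exists_ncard_eq_coverNum G
    obtain ⟨d, hd, hw, h2⟩ := exists_ncard_eq_coverNumAt H w
    have := coverNum_le (G := link G H v w) (d := sumSet c d)
      (isVertexCover_link_iff.2 (⟨by simpa, by simpa, by simp [sumSet, hw]⟩))
    rwa [ncard_sum, preimage_inl_sumSet, preimage_inr_sumSet, h1, h2] at this
  · obtain ⟨c, hc, h1⟩ := exists_ncard_eq_coverNum (link G H v w)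
    rw [isVertexCover_link_iff] at hc
    rw [← h1, ncard_sum]
    obtain ⟨ha, hb, hv | hw⟩ := hc
    · exact min_le_of_left_le (add_le_add (coverNumAt_le ha hv) (coverNum_le hb))
    · exact min_le_of_right_le (add_le_add (coverNum_le ha) (coverNumAt_le hb hw))

end CoverNumbers

/-! ### Kinds of rooted graphs with a vertex cover -/

/-- The kinds of graphs with a root and a vertex cover that occur on either side of an edge of
a tree with a minimum vertex cover. -/
inductive Kind
  /-- The cover is minimum and contains the root. -/
  | tight
  /-- The cover contains the root, is smallest among those, but some cover is smaller. -/
  | pending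
  /-- The cover is minimum and avoids the root, and no minimum cover contains the root. -/
  | free
  /-- The cover is minimum and avoids the root, but some minimum cover contains the root. -/
  | used
  deriving DecidableEq

instance : Fintype Kind :=
  ⟨{.tight, .pending, .free, .used}, fun k => by cases k <;> decide⟩

/-- The rooted graph `(G, r)` with the set `c` of vertices is of the given kind. -/
def Kind.Holds {V : Type*} (G : SimpleGraph V) (c : Set V) (r : V) : Kind → Prop
  | tight => G.IsVertexCover c ∧ r ∈ c ∧ c.ncard = coverNum G
  | pending => G.IsVertexCover c ∧ r ∈ c ∧ c.ncard = coverNumAt G r ∧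
      coverNumAt G r = coverNum G + 1
  | free => G.IsVertexCover c ∧ r ∉ c ∧ c.ncard = coverNum G ∧
      coverNumAt G r = coverNum G + 1
  | used => G.IsVertexCover c ∧ r ∉ c ∧ c.ncard = coverNum G ∧ coverNumAt G r = coverNum G

/-- The kind of the graph that arises when the root of a graph of the second kind is attached as a
child to the root of a graph of the first kind. -/
def Kind.attach : Kind → Kind → Option Kind
  | pending, tight => some pending
  | pending, used => some pending
  | pending, free => some tight
  | tight, tight => some tight
  | tight, used => some tight
  | tight, free => some tight
  | free, tight => some free
  | used, tight => some used
  | free, pending => some used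
  | _, _ => none

section Kind

variable {V W : Type*} [Finite V] [Finite W]

omit [Finite V] in
lemma Kind.Holds.unique {G : SimpleGraph V} {c : Set V} {r : V} {k l : Kind}
    (hk : k.Holds G c r) (hl : l.Holds G c r) : k = l := by
  cases k <;> cases l <;> simp only [Kind.Holds] at hk hl <;> first | rfl | (exfalso; grind)

omit [Finite V] in
lemma exists_holds {G : SimpleGraph V} {c : Set V} {r : V} (hc : G.IsVertexCover c)
    (h1 : r ∈ c → c.ncard ≤ coverNumAt G r) (h2 : r ∉ c → c.ncard ≤ coverNum G) :
    ∃ k : Kind, k.Holds G c r := by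
  have h3 := coverNum_le_coverNumAt G r
  have h4 := coverNumAt_le_succ G r
  have h5 := coverNum_le hc
  by_cases hr : r ∈ c
  · have h6 := h1 hr
    have h7 := coverNumAt_le hc hr
    by_cases h : c.ncard = coverNum G
    · exact ⟨.tight, hc, hr, h⟩
    · exact ⟨.pending, hc, hr, by omega, by omega⟩
  · have h6 := h2 hr
    by_cases h : coverNumAt G r = coverNum G
    · exact ⟨.used, hc, hr, by omega, h⟩
    · exact ⟨.free, hc, hr, by omega, by omega⟩

lemma isMinVertexCover_iff_holds {G : SimpleGraph V} {c : Set V} (r : V) :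
    IsMinVertexCover G c ↔
      Kind.tight.Holds G c r ∨ Kind.free.Holds G c r ∨ Kind.used.Holds G c r := by
  rw [isMinVertexCover_iff]
  have h3 := coverNum_le_coverNumAt G r
  have h4 := coverNumAt_le_succ G r
  simp only [Kind.Holds]
  grind

/-- The formulas for the linked cover numbers force each half of `c` to be as small as its behaviour
at its own root allows, so each half has a kind. The table `Kind.attach` is then arithmetic with
these formulas; its missing entries leave the linking edge uncovered or give a cover that is too
large. -/
lemma holds_link_iff {G : SimpleGraph V} {H : SimpleGraph W} {v : V} {w : W}
    {c : Set (V ⊕ W)} {k : Kind} :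
    k.Holds (link G H v w) c (.inl v) ↔ ∃ k₁ k₂ : Kind, k₁.attach k₂ = some k ∧
      k₁.Holds G (Sum.inl ⁻¹' c) v ∧ k₂.Holds H (Sum.inr ⁻¹' c) w := by
  have g1 := coverNum_le_coverNumAt G v
  have g2 := coverNumAt_le_succ G v
  have h1 := coverNum_le_coverNumAt H w
  have h2 := coverNumAt_le_succ H w
  have hn := ncard_sum c
  have ha := coverNumAt_link (G := G) (H := H) (v := v) (w := w)
  have hm := coverNum_link (G := G) (H := H) (v := v) (w := w)
  have hcov := isVertexCover_link_iff (G := G) (H := H) (v := v) (w := w) (c := c)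
  have hv : v ∈ (Sum.inl ⁻¹' c : Set V) ↔ Sum.inl v ∈ c := Iff.rfl
  have hw : w ∈ (Sum.inr ⁻¹' c : Set W) ↔ Sum.inr w ∈ c := Iff.rfl
  constructor
  · intro h
    have hc : (link G H v w).IsVertexCover c := by cases k <;> exact h.1
    obtain ⟨hc1, hc2, hvw⟩ := hcov.1 hc
    have l1 := coverNum_le hc1
    have l2 := coverNum_le hc2
    have l3 := fun h => coverNumAt_le hc1 (r := v) h
    have l4 := fun h => coverNumAt_le hc2 (r := w) h
    obtain ⟨k₁, hk₁⟩ := exists_holds (r := v) hc1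
      (by intro h; have := l3 h; cases k <;> simp only [Kind.Holds] at h <;> grind)
      (by intro h; cases k <;> simp only [Kind.Holds] at h <;> grind)
    obtain ⟨k₂, hk₂⟩ := exists_holds (r := w) hc2
      (by intro h; have := l4 h; cases k <;> simp only [Kind.Holds] at h <;> grind)
      (by intro h; cases k <;> simp only [Kind.Holds] at h <;> grind)
    refine ⟨k₁, k₂, ?_, hk₁, hk₂⟩
    cases k <;> cases k₁ <;> cases k₂ <;> simp only [Kind.Holds] at h hk₁ hk₂ <;>
      first | rfl | (exfalso; grind)
  · rintro ⟨k₁, k₂, hk, hk₁, hk₂⟩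
    have l3 : v ∈ (Sum.inl ⁻¹' c : Set V) → coverNumAt G v ≤ (Sum.inl ⁻¹' c : Set V).ncard := by
      cases k₁ <;> exact fun h => coverNumAt_le hk₁.1 h
    have l4 : w ∈ (Sum.inr ⁻¹' c : Set W) → coverNumAt H w ≤ (Sum.inr ⁻¹' c : Set W).ncard := by
      cases k₂ <;> exact fun h => coverNumAt_le hk₂.1 h
    cases k₁ <;> cases k₂ <;> simp only [Kind.attach, reduceCtorEq, Option.some.injEq] at hk <;>
      subst hk <;> simp only [Kind.Holds] at hk₁ hk₂ ⊢ <;> grind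

end Kind

end TreeVertexCovers

namespace TreeVertexCovers

open SimpleGraph

/-! ### Counting rooted trees with a vertex cover -/

section Transport

variable {V W : Type*} {G : SimpleGraph V} {H : SimpleGraph W}

lemma coverNum_le_of_iso (f : G ≃g H) : coverNum G ≤ coverNum H := by
  obtain ⟨d, hd, h⟩ := exists_ncard_eq_coverNum H
  have := coverNum_le ((isVertexCover_preimage_iso f).2 hd)
  rwa [Set.ncard_preimage_of_injective_subset_range f.injective (by simp [f.surjective.range_eq]),
    h] at this

lemma coverNum_eq_of_iso (f : G ≃g H) : coverNum G = coverNum H :=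
  le_antisymm (coverNum_le_of_iso f) (coverNum_le_of_iso f.symm)

lemma coverNumAt_le_of_iso (f : G ≃g H) (r : V) : coverNumAt G r ≤ coverNumAt H (f r) := by
  obtain ⟨d, hd, hr, h⟩ := exists_ncard_eq_coverNumAt H (f r)
  have := coverNumAt_le ((isVertexCover_preimage_iso f).2 hd) (r := r) hr
  rwa [Set.ncard_preimage_of_injective_subset_range f.injective (by simp [f.surjective.range_eq]),
    h] at this

lemma coverNumAt_eq_of_iso (f : G ≃g H) (r : V) : coverNumAt G r = coverNumAt H (f r) := by
  refine le_antisymm (coverNumAt_le_of_iso f r) ?_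
  simpa using coverNumAt_le_of_iso f.symm (f r)

lemma holds_iso (f : G ≃g H) {c : Set W} {r : V} {k : Kind} :
    k.Holds G (f ⁻¹' c) r ↔ k.Holds H c (f r) := by
  have h1 := coverNum_eq_of_iso f
  have h2 := coverNumAt_eq_of_iso f r
  have h3 : (f ⁻¹' c).ncard = c.ncard :=
    Set.ncard_preimage_of_injective_subset_range f.injective (by simp [f.surjective.range_eq])
  cases k <;> simp [Kind.Holds, h1, h2, h3]

lemma ncard_neighborSet_iso (f : G ≃g H) (r : V) :
    (G.neighborSet r).ncard = (H.neighborSet (f r)).ncard :=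
  Nat.card_congr (f.mapNeighborSet r)

end Transport

/-- The triples consisting of a tree, a set of vertices and a root that are of the kind `k`, where
the degree of the root satisfies `p`. -/
def rooted (V : Type*) (k : Kind) (p : ℕ → Prop) : Set (SimpleGraph V × Set V × V) :=
  {x | x.1.IsTree ∧ k.Holds x.1 x.2.1 x.2.2 ∧ p (x.1.neighborSet x.2.2).ncard}

/-- The vertices on the side of `u` when the edge from `u` to `v` is deleted. -/
def side {V : Type*} (G : SimpleGraph V) (u v : V) : Set V :=
  {x | (G.deleteEdges {s(u, v)}).Reachable u x}

/-- The trees with a set of vertices and an oriented edge from the root to another vertex, such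
that the rooted tree is of kind `k` and the number of other edges at the root satisfies `p`. -/
def edgeRooted (V : Type*) (k : Kind) (p : ℕ → Prop) : Set (SimpleGraph V × Set V × V × V) :=
  {x | x.1.IsTree ∧ x.1.Adj x.2.2.1 x.2.2.2 ∧ k.Holds x.1 x.2.1 x.2.2.1 ∧
    p ((x.1.neighborSet x.2.2.1).ncard - 1)}

/-- The elements of `edgeRooted V k p` where the side of the root is `S`. -/
def edgeRootedSide (V : Type*) (k : Kind) (p : ℕ → Prop) (S : Set V) :
    Set (SimpleGraph V × Set V × V × V) :=
  {x | x ∈ edgeRooted V k p ∧ side x.1 x.2.2.1 x.2.2.2 = S}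

/-! ### Cutting a tree at a marked edge of the root. -/

section Counting

variable {V W : Type*} {k : Kind} {p : ℕ → Prop}

/-- Cutting produces trees on arbitrary subsets of the labels; relabeling brings them back to `Fin
m`. -/
lemma card_rooted_congr (e : V ≃ W) : Nat.card (rooted V k p) = Nat.card (rooted W k p) := by
  let E : (SimpleGraph W × Set W × W) ≃ (SimpleGraph V × Set V × V) :=
    (e.symm.simpleGraph).prodCongr ((Equiv.Set.congr e.symm).prodCongr e.symm)
  refine (Nat.card_congr (E.subtypeEquiv fun x => ?_)).symm
  obtain ⟨G, c, r⟩ := x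
  let f : G.comap e ≃g G := Iso.comap e G
  have h1 : f (e.symm r) = r := e.apply_symm_apply r
  have h2 : (Equiv.Set.congr e.symm) c = f ⁻¹' c := by
    ext x; simp [f, Equiv.Set.congr, Equiv.image_symm_eq_preimage]
  have h3 := ncard_neighborSet_iso f (e.symm r)
  have h4 := holds_iso f (c := c) (r := e.symm r) (k := k)
  rw [h1] at h3 h4
  have h5 : E (G, c, r) = (G.comap e, f ⁻¹' c, e.symm r) := by
    rw [← h2]; rfl
  rw [h5]
  simp only [rooted, Set.mem_ofPred_eq]
  rw [h3, h4, f.isTree_iff]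

lemma side_comap (e : V ≃ W) (G : SimpleGraph W) (u v : W) :
    side (G.comap e) (e.symm u) (e.symm v) = e ⁻¹' side G u v := by
  ext x
  let f : (G.comap e).deleteEdges {s(e.symm u, e.symm v)} ≃g G.deleteEdges {s(u, v)} :=
    ⟨e, by
      intro a b
      simp only [SimpleGraph.deleteEdges_adj, SimpleGraph.comap_adj, Set.mem_singleton_iff, Sym2.eq_iff,
        Equiv.eq_symm_apply]⟩
  have := f.reachable_iff (u := e.symm u) (v := x)
  simp only [side, Set.mem_ofPred_eq, Set.mem_preimage]
  rw [← this]
  simp [f]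

lemma card_edgeRootedSide_congr (e : V ≃ W) (S : Set W) :
    Nat.card (edgeRootedSide V k p (e ⁻¹' S)) = Nat.card (edgeRootedSide W k p S) := by
  let E : (SimpleGraph W × Set W × W × W) ≃ (SimpleGraph V × Set V × V × V) :=
    (e.symm.simpleGraph).prodCongr
      ((Equiv.Set.congr e.symm).prodCongr (e.symm.prodCongr e.symm))
  refine (Nat.card_congr (E.subtypeEquiv fun x => ?_)).symm
  obtain ⟨G, c, u, v⟩ := x
  let f : G.comap e ≃g G := Iso.comap e G
  have h1 : f (e.symm u) = u := e.apply_symm_apply u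
  have h2 : (Equiv.Set.congr e.symm) c = f ⁻¹' c := by
    ext x; simp [f, Equiv.Set.congr, Equiv.image_symm_eq_preimage]
  have h3 := ncard_neighborSet_iso f (e.symm u)
  have h4 := holds_iso f (c := c) (r := e.symm u) (k := k)
  rw [h1] at h3 h4
  have h5 : E (G, c, u, v) = (G.comap e, f ⁻¹' c, e.symm u, e.symm v) := by
    rw [← h2]; rfl
  rw [h5]
  simp only [edgeRootedSide, edgeRooted, Set.mem_ofPred_eq]
  rw [h3, h4, f.isTree_iff, side_comap, Set.preimage_eq_preimage e.surjective]
  simp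

lemma sumSet_injective : Function.Injective fun x : Set V × Set W => sumSet x.1 x.2 := by
  rintro ⟨a, b⟩ ⟨c, d⟩ h
  have h1 := congrArg (fun s => Sum.inl ⁻¹' s) h
  have h2 := congrArg (fun s => Sum.inr ⁻¹' s) h
  simp only [preimage_inl_sumSet, preimage_inr_sumSet] at h1 h2
  rw [h1, h2]

lemma sumSet_preimage (c : Set (V ⊕ W)) : sumSet (Sum.inl ⁻¹' c) (Sum.inr ⁻¹' c) = c :=
  Set.image_preimage_inl_union_image_preimage_inr c

lemma link_injective {G G' : SimpleGraph V} {H H' : SimpleGraph W} {v v' : V} {w w' : W}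
    (h : link G H v w = link G' H' v' w') : G = G' ∧ H = H' := by
  constructor
  · ext a b
    rw [← link_adj_inl_inl (H := H) (v := v) (w := w), h, link_adj_inl_inl]
  · ext a b
    rw [← link_adj_inr_inr (G := G) (v := v) (w := w), h, link_adj_inr_inr]

lemma side_link {G : SimpleGraph V} {H : SimpleGraph W} {v : V} {w : W} (hG : G.Connected) :
    side (link G H v w) (.inl v) (.inr w) = Set.range Sum.inl := by
  ext x
  rw [side, Set.mem_ofPred_eq, reachable_deleteEdges_link hG]
  cases x <;> simp

/-- Every edge of a tree is a bridge, so the only edge between the two sides is the deleted one. -/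
lemma eq_link_of_side {G : SimpleGraph (V ⊕ W)} {u v : V ⊕ W} (hG : G.IsTree) (huv : G.Adj u v)
    (hS : side G u v = Set.range Sum.inl) :
    ∃ a b, u = .inl a ∧ v = .inr b ∧ G = link (G.comap Sum.inl) (G.comap Sum.inr) a b := by
  have hu : u ∈ side G u v := Reachable.refl _
  have hv : v ∉ side G u v :=
    isBridge_iff.1 (isAcyclic_iff_forall_adj_isBridge.1 hG.isAcyclic huv)
  have hcross : ∀ x ∈ side G u v, ∀ y ∉ side G u v, G.Adj x y → x = u ∧ y = v := by
    intro x hx y hy hxy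
    by_contra hne
    refine hy (Reachable.trans hx (Adj.reachable ?_))
    rw [SimpleGraph.deleteEdges_adj]
    refine ⟨hxy, fun h => ?_⟩
    rw [Set.mem_singleton_iff, Sym2.eq_iff] at h
    rcases h with h | ⟨rfl, rfl⟩
    · exact hne h
    · exact hv hx
  rw [hS] at hu hv hcross
  obtain ⟨a, rfl⟩ := hu
  obtain ⟨b, rfl⟩ : ∃ b, v = Sum.inr b := by
    rcases v with v | v
    · exact absurd ⟨v, rfl⟩ hv
    · exact ⟨v, rfl⟩
  have hcr : ∀ x y, G.Adj (.inl x) (.inr y) ↔ x = a ∧ y = b := by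
    intro x y
    constructor
    · intro h
      simpa using hcross _ ⟨x, rfl⟩ (.inr y) (by simp) h
    · rintro ⟨rfl, rfl⟩
      exact huv
  refine ⟨a, b, rfl, rfl, ?_⟩
  ext (x | x) (y | y)
  · simp
  · simp [hcr]
  · rw [G.adj_comm]; simp [hcr]
  · simp

lemma mem_edgeRootedSide_link_iff [Finite V] [Finite W] {G : SimpleGraph V} {H : SimpleGraph W}
    {v : V} {w : W} {c : Set V} {d : Set W} :
    (link G H v w, sumSet c d, Sum.inl v, Sum.inr w) ∈
        edgeRootedSide (V ⊕ W) k p (Set.range Sum.inl) ↔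
      ∃ k₁ k₂ : Kind, k₁.attach k₂ = some k ∧ (G, c, v) ∈ rooted V k₁ p ∧
        (H, d, w) ∈ rooted W k₂ fun _ => True := by
  simp only [edgeRootedSide, edgeRooted, rooted, Set.mem_ofPred_eq, isTree_link_iff, holds_link_iff,
    preimage_inl_sumSet, preimage_inr_sumSet, ncard_neighborSet_link, Nat.add_sub_cancel]
  constructor
  · rintro ⟨⟨⟨hG, hH⟩, -, ⟨k₁, k₂, hk, h1, h2⟩, hp⟩, -⟩
    exact ⟨k₁, k₂, hk, ⟨hG, h1, hp⟩, hH, h2, trivial⟩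
  · rintro ⟨k₁, k₂, hk, ⟨hG, h1, hp⟩, hH, h2, -⟩
    exact ⟨⟨⟨hG, hH⟩, by simp, ⟨k₁, k₂, hk, h1, h2⟩, hp⟩, side_link hG.connected⟩

lemma card_edgeRootedSide_sum [Finite V] [Finite W] :
    Nat.card (edgeRootedSide (V ⊕ W) k p (Set.range Sum.inl)) =
      ∑ κ : Kind × Kind with κ.1.attach κ.2 = some k,
        Nat.card (rooted V κ.1 p) * Nat.card (rooted W κ.2 fun _ => True) := by
  let F : (Σ κ : {κ : Kind × Kind // κ.1.attach κ.2 = some k},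
      rooted V κ.1.1 p × rooted W κ.1.2 fun _ => True) →
      edgeRootedSide (V ⊕ W) k p (Set.range Sum.inl) := fun x =>
    ⟨(link x.2.1.1.1 x.2.2.1.1 x.2.1.1.2.2 x.2.2.1.2.2, sumSet x.2.1.1.2.1 x.2.2.1.2.1,
      Sum.inl x.2.1.1.2.2, Sum.inr x.2.2.1.2.2),
      mem_edgeRootedSide_link_iff.2 ⟨_, _, x.1.2, x.2.1.2, x.2.2.2⟩⟩
  have hF : Function.Bijective F := by
    constructor
    · rintro ⟨⟨⟨k₁, k₂⟩, hk⟩, ⟨⟨G, c, v⟩, h1⟩, ⟨⟨H, d, w⟩, h2⟩⟩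
        ⟨⟨⟨l₁, l₂⟩, hl⟩, ⟨⟨G', c', v'⟩, h1'⟩, ⟨⟨H', d', w'⟩, h2'⟩⟩ h
      simp only [F, Subtype.mk.injEq, Prod.mk.injEq, Sum.inl.injEq, Sum.inr.injEq] at h
      obtain ⟨hl', hs, rfl, rfl⟩ := h
      obtain ⟨rfl, rfl⟩ := link_injective hl'
      have hs' := sumSet_injective (a₁ := (c, d)) (a₂ := (c', d')) hs
      rw [Prod.mk.injEq] at hs'
      obtain ⟨rfl, rfl⟩ := hs'
      -- The kinds are determined by the two halves, so the sum over pairs of kinds counts nothing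
      -- twice.
      obtain rfl : k₁ = l₁ := h1.2.1.unique h1'.2.1
      obtain rfl : k₂ = l₂ := h2.2.1.unique h2'.2.1
      rfl
    · rintro ⟨⟨G, c, u, v⟩, hx⟩
      obtain ⟨a, b, rfl, rfl, hGl⟩ := eq_link_of_side (G := G) hx.1.1 hx.1.2.1 hx.2
      have hx' : (link (G.comap Sum.inl) (G.comap Sum.inr) a b,
          sumSet (Sum.inl ⁻¹' c) (Sum.inr ⁻¹' c), Sum.inl a, Sum.inr b) ∈
          edgeRootedSide (V ⊕ W) k p (Set.range Sum.inl) := by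
        rw [← hGl, sumSet_preimage]; exact hx
      rw [mem_edgeRootedSide_link_iff] at hx'
      obtain ⟨k₁, k₂, hk, h1, h2⟩ := hx'
      refine ⟨⟨⟨(k₁, k₂), hk⟩, ⟨_, h1⟩, ⟨_, h2⟩⟩, ?_⟩
      simp only [F, Subtype.mk.injEq, Prod.mk.injEq, and_true]
      exact ⟨hGl.symm, sumSet_preimage c⟩
  rw [← Nat.card_congr (Equiv.ofBijective F hF), Nat.card_sigma]
  simp only [Nat.card_prod]
  exact (Finset.sum_subtype _ (by simp) fun κ : Kind × Kind =>
    Nat.card (rooted V κ.1 p) * Nat.card (rooted W κ.2 fun _ => True)).symm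

/-- Cutting the marked edge decomposes a tree into two rooted trees. -/
lemma card_edgeRooted (n : ℕ) (k : Kind) (p : ℕ → Prop) :
    Nat.card (edgeRooted (Fin n) k p) = ∑ m ∈ Finset.range (n + 1), n.choose m *
      ∑ κ : Kind × Kind with κ.1.attach κ.2 = some k,
        Nat.card (rooted (Fin m) κ.1 p) * Nat.card (rooted (Fin (n - m)) κ.2 fun _ => True) := by
  classical
  -- The trees are sorted by the label set of the root's side; each fibre depends only on the size
  -- of that set, which produces the binomial coefficients.
  let φ : edgeRooted (Fin n) k p → Finset (Fin n) := fun x =>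
    (side x.1.1 x.1.2.2.1 x.1.2.2.2).toFinset
  rw [← Nat.card_congr (Equiv.sigmaFiberEquiv φ), Nat.card_sigma]
  let g : ℕ → ℕ := fun m => ∑ κ : Kind × Kind with κ.1.attach κ.2 = some k,
        Nat.card (rooted (Fin m) κ.1 p) * Nat.card (rooted (Fin (n - m)) κ.2 fun _ => True)
  have key : ∀ S : Finset (Fin n), Nat.card {x // φ x = S} = g S.card := by
    intro S
    have e1 : {x // φ x = S} ≃ edgeRootedSide (Fin n) k p ↑S :=
      (Equiv.subtypeSubtypeEquivSubtypeInter (fun x => x ∈ edgeRooted (Fin n) k p)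
        fun x => (side x.1 x.2.2.1 x.2.2.2).toFinset = S).trans
        (Equiv.subtypeEquivRight fun x => by
          simp only [edgeRootedSide, Set.mem_ofPred_eq]
          rw [← Finset.coe_inj, Set.coe_toFinset])
    have e2 := card_edgeRootedSide_congr (k := k) (p := p) (Equiv.sumCompl (· ∈ S)) ↑S
    have e3 : Equiv.sumCompl (· ∈ S) ⁻¹' ↑S = Set.range (Sum.inl : {a // a ∈ S} → _) := by
      ext (x | x) <;> simp [x.2]
    rw [Nat.card_congr e1, ← e2, e3, card_edgeRootedSide_sum]
    refine Finset.sum_congr rfl fun κ _ => ?_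
    have f1 : {a // a ∈ S} ≃ Fin S.card := Fintype.equivFinOfCardEq (by simp)
    have f2 : {a // ¬ a ∈ S} ≃ Fin (n - S.card) :=
      Fintype.equivFinOfCardEq (by
        rw [Fintype.card_subtype_compl]; simp)
    rw [card_rooted_congr f1, card_rooted_congr f2]
  simp only [key]
  have := Finset.sum_powerset_apply_card g (x := (Finset.univ : Finset (Fin n)))
  rw [Finset.powerset_univ, Finset.card_univ, Fintype.card_fin] at this
  exact this

/-- The edges at the root of a rooted tree. -/
lemma card_edgeRooted_eq (n d : ℕ) (k : Kind) :
    Nat.card (edgeRooted (Fin n) k (· = d)) =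
      (d + 1) * Nat.card (rooted (Fin n) k (· = d + 1)) := by
  let e : edgeRooted (Fin n) k (· = d) ≃ Σ x : rooted (Fin n) k (· = d + 1),
      x.1.1.neighborSet x.1.2.2 :=
    { toFun := fun x => ⟨⟨(x.1.1, x.1.2.1, x.1.2.2.1), x.2.1, x.2.2.2.1, by
          have := x.2.2.2.2
          -- The marked edge makes the degree positive, so the truncated subtraction in `edgeRooted`
          -- loses nothing.
          have h0 : 0 < (x.1.1.neighborSet x.1.2.2.1).ncard :=
            (Set.ncard_pos (Set.toFinite _)).2 ⟨x.1.2.2.2, x.2.2.1⟩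
          simp only at this ⊢
          omega⟩, ⟨x.1.2.2.2, x.2.2.1⟩⟩
      invFun := fun x => ⟨(x.1.1.1, x.1.1.2.1, x.1.1.2.2, x.2.1), x.1.2.1, x.2.2, x.1.2.2.1, by
          have := x.1.2.2.2
          simp only at this ⊢
          omega⟩
      left_inv := fun _ => rfl
      right_inv := fun _ => rfl }
  have := Fintype.ofFinite (rooted (Fin n) k (· = d + 1))
  rw [Nat.card_congr e, Nat.card_sigma, Finset.sum_congr rfl fun x _ => x.2.2.2]
  simp [mul_comm, Nat.card_eq_fintype_card]

end Counting

end TreeVertexCovers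

namespace TreeVertexCovers

open SimpleGraph

/-! ### Splitting by the degree of the root, and the tree with one vertex. -/

section Degree

variable {n : ℕ} {k : Kind}

lemma ncard_neighborSet_lt (G : SimpleGraph (Fin n)) (r : Fin n) : (G.neighborSet r).ncard < n := by
  have : G.neighborSet r ⊂ Set.univ :=
    (Set.ssubset_univ_iff).2 fun h => G.irrefl (v := r) (by
      have : r ∈ G.neighborSet r := h ▸ Set.mem_univ r
      exact this)
  simpa [Set.ncard_univ] using Set.ncard_lt_ncard this

lemma card_rooted_eq_sum (k : Kind) {n N : ℕ} (hN : n ≤ N) :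
    Nat.card (rooted (Fin n) k fun _ => True) =
      ∑ d ∈ Finset.range N, Nat.card (rooted (Fin n) k (· = d)) := by
  let φ : rooted (Fin n) k (fun _ => True) → Fin N := fun x =>
    ⟨(x.1.1.neighborSet x.1.2.2).ncard, (ncard_neighborSet_lt _ _).trans_le hN⟩
  rw [← Nat.card_congr (Equiv.sigmaFiberEquiv φ), Nat.card_sigma, ← Fin.sum_univ_eq_sum_range
    (fun d => Nat.card (rooted (Fin n) k (· = d)))]
  refine Finset.sum_congr rfl fun d _ => Nat.card_congr ?_
  exact (Equiv.subtypeSubtypeEquivSubtypeInter (fun x => x ∈ rooted (Fin n) k fun _ => True)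
    fun x => (⟨(x.1.neighborSet x.2.2).ncard, (ncard_neighborSet_lt _ _).trans_le hN⟩ : Fin N) =
      d).trans (Equiv.subtypeEquivRight fun x => by
        simp [rooted, Fin.ext_iff, and_assoc])

lemma card_rooted_zero (k : Kind) (p : ℕ → Prop) : Nat.card (rooted (Fin 0) k p) = 0 := by
  have : IsEmpty (rooted (Fin 0) k p) := ⟨fun x => x.1.2.2.elim0⟩
  simp

lemma card_rooted_degree_zero (hn : n ≠ 1) : Nat.card (rooted (Fin n) k (· = 0)) = 0 := by
  have : IsEmpty (rooted (Fin n) k (· = 0)) := by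
    constructor
    rintro ⟨⟨G, c, r⟩, hG, -, hr⟩
    have hn2 : 1 < n := by have := r.pos; omega
    have : Nontrivial (Fin n) := Fin.nontrivial_iff_two_le.2 hn2
    obtain ⟨s, hs⟩ := hG.connected.preconnected.exists_adj_of_nontrivial r
    have : (G.neighborSet r).ncard ≠ 0 := (Set.ncard_ne_zero_of_mem (a := s) hs)
    exact this hr
  simp

lemma isVertexCover_of_subsingleton {V : Type*} [Subsingleton V] (G : SimpleGraph V) (c : Set V) :
    G.IsVertexCover c := fun a b h => absurd (Subsingleton.elim a b) h.ne

lemma coverNum_fin_one (G : SimpleGraph (Fin 1)) : coverNum G = 0 := by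
  have := coverNum_le (isVertexCover_of_subsingleton G ∅)
  simpa using this

lemma coverNumAt_fin_one (G : SimpleGraph (Fin 1)) (r : Fin 1) : coverNumAt G r = 1 := by
  refine le_antisymm (by simpa [coverNum_fin_one] using coverNumAt_le_succ G r) ?_
  obtain ⟨d, -, hr, h⟩ := exists_ncard_eq_coverNumAt G r
  rw [← h]
  exact (Set.ncard_pos d.toFinite).2 ⟨r, hr⟩

/-- On one vertex the empty set is a minimum cover and every cover containing the root has size one:
the full set is pending, the empty set free. -/
lemma card_rooted_one (k : Kind) : Nat.card (rooted (Fin 1) k (· = 0)) =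
    if k = .pending ∨ k = .free then 1 else 0 := by
  classical
  have hdeg : ∀ (G : SimpleGraph (Fin 1)) (r : Fin 1), (G.neighborSet r).ncard = 0 := fun G r => by
    have := ncard_neighborSet_lt G r; omega
  have htree : ∀ G : SimpleGraph (Fin 1), G.IsTree := fun G => .of_subsingleton
  have hset : ∀ c : Set (Fin 1), c.ncard = if 0 ∈ c then 1 else 0 := fun c => by
    split_ifs with h
    · rw [show c = {0} by ext x; simp [Subsingleton.elim x 0, h], Set.ncard_singleton]
    · rw [show c = ∅ by ext x; simp [Subsingleton.elim x 0, h], Set.ncard_empty]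
  have key : ∀ c₀ : Set (Fin 1), (∀ c, k.Holds (⊥ : SimpleGraph (Fin 1)) c 0 ↔ c = c₀) →
      Nat.card (rooted (Fin 1) k (· = 0)) = 1 := by
    intro c₀ h
    have : rooted (Fin 1) k (· = 0) = {(⊥, c₀, 0)} := by
      ext ⟨G, c, r⟩
      obtain rfl : G = ⊥ := Subsingleton.elim _ _
      obtain rfl : r = 0 := Subsingleton.elim _ _
      simp [rooted, htree, h]
    rw [this]; simp
  cases k
  · have : IsEmpty (rooted (Fin 1) .tight (· = 0)) := by
      constructor
      rintro ⟨⟨G, c, r⟩, -, ⟨-, hr, h⟩, -⟩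
      rw [coverNum_fin_one, Set.ncard_eq_zero] at h
      simp_all
    simp
  · rw [key Set.univ fun c => ?_]
    · simp
    · simp only [Kind.Holds, isVertexCover_of_subsingleton, coverNum_fin_one, coverNumAt_fin_one,
        hset, true_and, zero_add, and_true]
      constructor
      · rintro ⟨h, -⟩
        ext x; simp [Subsingleton.elim x 0, h]
      · rintro rfl; simp
  · rw [key ∅ fun c => ?_]
    · simp
    · simp only [Kind.Holds, isVertexCover_of_subsingleton, coverNum_fin_one, coverNumAt_fin_one,
        hset, true_and, zero_add, and_true]
      constructor
      · rintro ⟨h, -⟩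
        ext x; simp [Subsingleton.elim x 0, h]
      · rintro rfl; simp
  · have : IsEmpty (rooted (Fin 1) .used (· = 0)) := by
      constructor
      rintro ⟨⟨G, c, r⟩, -, ⟨-, -, -, h'⟩, -⟩
      rw [coverNum_fin_one, coverNumAt_fin_one] at h'
      simp at h'
    simp

end Degree

/-! ### Passing between trees and trees with a marked vertex or oriented edge. -/

section Unrooted

/-- The pairs of a labeled tree and a minimum vertex cover of it. -/
def treeCovers (n : ℕ) : Set (SimpleGraph (Fin n) × Set (Fin n)) :=
  {x | x.1.IsTree ∧ IsMinVertexCover x.1 x.2}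

lemma numMinVertexCovers_eq_card (n : ℕ) : numMinVertexCovers n = Nat.card (treeCovers n) := by
  classical
  let e : treeCovers n ≃ Σ G : {G : SimpleGraph (Fin n) // G.IsTree},
      {c : Set (Fin n) | IsMinVertexCover G.1 c} :=
    { toFun := fun x => ⟨⟨x.1.1, x.2.1⟩, ⟨x.1.2, x.2.2⟩⟩
      invFun := fun x => ⟨(x.1.1, x.2.1), x.1.2, x.2.2⟩
      left_inv := fun _ => rfl
      right_inv := fun _ => rfl }
  rw [Nat.card_congr e, Nat.card_sigma, numMinVertexCovers]
  exact Finset.sum_subtype _ (by simp) fun G : SimpleGraph (Fin n) =>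
    {c : Set (Fin n) | IsMinVertexCover G c}.ncard

/-- The kinds exclude each other, so the count is additive. The type `α` is left general to serve
both vertex-rooted and edge-rooted trees. -/
lemma card_kinds_eq {α : Type*} [Finite α] {n : ℕ} (A : Kind → Set α) (B : Set α)
    (f : α → SimpleGraph (Fin n) × Set (Fin n) × Fin n)
    (hA : ∀ k, ∀ x ∈ A k, k.Holds (f x).1 (f x).2.1 (f x).2.2)
    (hB : ∀ x, x ∈ B ↔ x ∈ A .tight ∨ x ∈ A .free ∨ x ∈ A .used) :
    Nat.card B = Nat.card (A .tight) + Nat.card (A .free) + Nat.card (A .used) := by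
  have hd : ∀ k l : Kind, k ≠ l → Disjoint (A k) (A l) := fun k l hkl =>
    Set.disjoint_left.2 fun x hk hl => hkl ((hA k x hk).unique (hA l x hl))
  have : B = A .tight ∪ (A .free ∪ A .used) := by ext x; simp [hB]
  simp only [Nat.card_coe_set_eq]
  rw [this, Set.ncard_union_eq, Set.ncard_union_eq (hd _ _ (by decide)), add_assoc]
  rw [Set.disjoint_union_right]
  exact ⟨hd _ _ (by decide), hd _ _ (by decide)⟩

/-- Every vertex of a tree with a minimum vertex cover can be chosen as root. -/
lemma mul_numMinVertexCovers (n : ℕ) : n * numMinVertexCovers n =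
    Nat.card (rooted (Fin n) .tight fun _ => True) + Nat.card (rooted (Fin n) .free fun _ => True) +
      Nat.card (rooted (Fin n) .used fun _ => True) := by
  rw [← card_kinds_eq (fun k => rooted (Fin n) k fun _ => True)
    {x | x.1.IsTree ∧ IsMinVertexCover x.1 x.2.1} id (fun k x hx => hx.2.1) fun x => by
      simp only [rooted, Set.mem_ofPred_eq, isMinVertexCover_iff_holds x.2.2]; tauto,
    numMinVertexCovers_eq_card]
  let e : {x : SimpleGraph (Fin n) × Set (Fin n) × Fin n | x.1.IsTree ∧ IsMinVertexCover x.1 x.2.1} ≃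
      Fin n × treeCovers n :=
    { toFun := fun x => ⟨x.1.2.2, ⟨(x.1.1, x.1.2.1), x.2⟩⟩
      invFun := fun x => ⟨(x.2.1.1, x.2.1.2, x.1), x.2.2⟩
      left_inv := fun _ => rfl
      right_inv := fun _ => rfl }
  rw [Nat.card_congr e, Nat.card_prod, Nat.card_fin]

lemma card_darts {n : ℕ} {G : SimpleGraph (Fin n)} (hG : G.IsTree) :
    Nat.card {x : Fin n × Fin n // G.Adj x.1 x.2} = 2 * (n - 1) := by
  classical
  let e : {x : Fin n × Fin n // G.Adj x.1 x.2} ≃ G.Dart :=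
    { toFun := fun x => ⟨x.1, x.2⟩
      invFun := fun x => ⟨x.1, x.2⟩
      left_inv := fun _ => rfl
      right_inv := fun _ => rfl }
  have := hG.card_edgeFinset
  rw [Nat.card_congr e, Nat.card_eq_fintype_card, G.dart_card_eq_twice_card_edges]
  rw [Fintype.card_fin] at this
  omega

/-- Every oriented edge of a tree with a minimum vertex cover can be marked. -/
lemma two_mul_numMinVertexCovers (n : ℕ) : 2 * (n - 1) * numMinVertexCovers n =
    Nat.card (edgeRooted (Fin n) .tight fun _ => True) +
      Nat.card (edgeRooted (Fin n) .free fun _ => True) +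
      Nat.card (edgeRooted (Fin n) .used fun _ => True) := by
  rw [← card_kinds_eq (fun k => edgeRooted (Fin n) k fun _ => True)
    {x | x.1.IsTree ∧ x.1.Adj x.2.2.1 x.2.2.2 ∧ IsMinVertexCover x.1 x.2.1}
    (fun x => (x.1, x.2.1, x.2.2.1)) (fun k x hx => hx.2.2.1) fun x => by
      simp only [edgeRooted, Set.mem_ofPred_eq, isMinVertexCover_iff_holds x.2.2.1]; tauto,
    numMinVertexCovers_eq_card]
  let e : {x : SimpleGraph (Fin n) × Set (Fin n) × Fin n × Fin n |
        x.1.IsTree ∧ x.1.Adj x.2.2.1 x.2.2.2 ∧ IsMinVertexCover x.1 x.2.1} ≃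
      Σ x : treeCovers n, {y : Fin n × Fin n // x.1.1.Adj y.1 y.2} :=
    { toFun := fun x => ⟨⟨(x.1.1, x.1.2.1), x.2.1, x.2.2.2⟩, ⟨x.1.2.2, x.2.2.1⟩⟩
      invFun := fun x => ⟨(x.1.1.1, x.1.1.2, x.2.1), x.1.2.1, x.2.2, x.1.2.2⟩
      left_inv := fun _ => rfl
      right_inv := fun _ => rfl }
  have := Fintype.ofFinite (treeCovers n)
  rw [Nat.card_congr e, Nat.card_sigma, Finset.sum_congr rfl fun x _ => card_darts x.2.1]
  simp [mul_comm, Nat.card_eq_fintype_card]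

end Unrooted

/-! ### Generating functions -/

/-- The exponential generating function of the rooted trees with a vertex cover that are of the kind
`k`, where the degree of the root satisfies `p`. -/
noncomputable def rootedSeries (k : Kind) (p : ℕ → Prop) : ℚ⟦X⟧ :=
  egf fun n => Nat.card (rooted (Fin n) k p)

/-- The exponential generating function of the rooted trees of kind `k` with a marked edge at the
root. -/
noncomputable def edgeRootedSeries (k : Kind) (p : ℕ → Prop) : ℚ⟦X⟧ :=
  egf fun n => Nat.card (edgeRooted (Fin n) k p)

/-- The exponential generating function of all rooted trees with a vertex cover of kind `k`. -/
noncomputable abbrev kindSeries (k : Kind) : ℚ⟦X⟧ := rootedSeries k fun _ => True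

lemma coeff_egf {a : ℕ → ℕ} (ha : a 0 = 0) (n : ℕ) : coeff n (egf a) = (a n : ℚ) / n.factorial := by
  rw [egf, coeff_mk]
  split_ifs with h
  · simp [h, ha]
  · rfl

lemma coeff_rootedSeries (k : Kind) (p : ℕ → Prop) (n : ℕ) :
    coeff n (rootedSeries k p) = (Nat.card (rooted (Fin n) k p) : ℚ) / n.factorial :=
  coeff_egf (card_rooted_zero k p) n

lemma coeff_edgeRootedSeries (k : Kind) (p : ℕ → Prop) (n : ℕ) :
    coeff n (edgeRootedSeries k p) = (Nat.card (edgeRooted (Fin n) k p) : ℚ) / n.factorial := by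
  refine coeff_egf ?_ n
  have : IsEmpty (edgeRooted (Fin 0) k p) := ⟨fun x => x.1.2.2.1.elim0⟩
  simp

/-- The binomial convolution of `card_edgeRooted` is the product of exponential generating
functions. -/
lemma edgeRootedSeries_eq (k : Kind) (p : ℕ → Prop) : edgeRootedSeries k p =
    ∑ κ : Kind × Kind with κ.1.attach κ.2 = some k, rootedSeries κ.1 p * kindSeries κ.2 := by
  ext n
  have hn : (n.factorial : ℚ) ≠ 0 := by positivity
  rw [coeff_edgeRootedSeries, card_edgeRooted, map_sum]
  simp only [coeff_mul, coeff_rootedSeries]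
  rw [Finset.sum_comm, Finset.Nat.sum_antidiagonal_eq_sum_range_succ_mk]
  push_cast
  rw [Finset.sum_div]
  refine Finset.sum_congr rfl fun m hm => ?_
  have hm' : m ≤ n := Nat.lt_succ_iff.1 (Finset.mem_range.1 hm)
  rw [Nat.cast_choose ℚ hm', Finset.mul_sum, Finset.sum_div]
  refine Finset.sum_congr rfl fun κ _ => ?_
  field_simp

lemma edgeRootedSeries_tight (p : ℕ → Prop) : edgeRootedSeries .tight p =
    rootedSeries .pending p * kindSeries .free + rootedSeries .tight p *
      (kindSeries .tight + kindSeries .free + kindSeries .used) := by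
  rw [edgeRootedSeries_eq, show (Finset.univ.filter fun κ : Kind × Kind =>
    κ.1.attach κ.2 = some .tight) = {(.pending, .free), (.tight, .tight), (.tight, .free),
      (.tight, .used)} by decide]
  simp; ring

lemma edgeRootedSeries_pending (p : ℕ → Prop) : edgeRootedSeries .pending p =
    rootedSeries .pending p * (kindSeries .tight + kindSeries .used) := by
  rw [edgeRootedSeries_eq, show (Finset.univ.filter fun κ : Kind × Kind =>
    κ.1.attach κ.2 = some .pending) = {(.pending, .tight), (.pending, .used)} by decide]
  simp; ring

lemma edgeRootedSeries_free (p : ℕ → Prop) : edgeRootedSeries .free p =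
    rootedSeries .free p * kindSeries .tight := by
  rw [edgeRootedSeries_eq, show (Finset.univ.filter fun κ : Kind × Kind =>
    κ.1.attach κ.2 = some .free) = {(.free, .tight)} by decide]
  simp

lemma edgeRootedSeries_used (p : ℕ → Prop) : edgeRootedSeries .used p =
    rootedSeries .used p * kindSeries .tight + rootedSeries .free p * kindSeries .pending := by
  rw [edgeRootedSeries_eq, show (Finset.univ.filter fun κ : Kind × Kind =>
    κ.1.attach κ.2 = some .used) = {(.used, .tight), (.free, .pending)} by decide]
  simp

/-- A root of degree `d + 1` has `d + 1` edges to mark. Together with the formulas for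
`edgeRootedSeries` this is a recursion in the root degree, of the type satisfied by a^d / d!. -/
lemma succ_smul_rootedSeries (k : Kind) (d : ℕ) :
    ((d : ℚ) + 1) • rootedSeries k (· = d + 1) = edgeRootedSeries k (· = d) := by
  ext n
  rw [map_smul, coeff_edgeRootedSeries, coeff_rootedSeries, card_edgeRooted_eq]
  push_cast
  rw [smul_eq_mul, mul_div_assoc]

lemma rootedSeries_degree_zero (k : Kind) : rootedSeries k (· = 0) =
    if k = .pending ∨ k = .free then X else 0 := by
  ext n
  rw [coeff_rootedSeries]
  by_cases hn : n = 1
  · subst hn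
    rw [card_rooted_one]
    split_ifs <;> simp
  · rw [card_rooted_degree_zero hn]
    split_ifs <;> simp [coeff_X, hn]

lemma coeff_kindSeries (k : Kind) {n N : ℕ} (hN : n ≤ N) : coeff n (kindSeries k) =
    ∑ d ∈ Finset.range N, coeff n (rootedSeries k (· = d)) := by
  simp only [coeff_rootedSeries]
  rw [card_rooted_eq_sum k hN, Nat.cast_sum, Finset.sum_div]

lemma coeff_vcSeries (n : ℕ) : coeff n vcSeries = (numMinVertexCovers n : ℚ) / n.factorial := by
  refine coeff_egf ?_ n
  rw [numMinVertexCovers_eq_card]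
  have : IsEmpty (treeCovers 0) := ⟨fun x => x.2.1.connected.nonempty.some.elim0⟩
  simp

lemma natCast_mul_coeff_vcSeries (n : ℕ) : (n : ℚ) * coeff n vcSeries =
    coeff n (kindSeries .tight + kindSeries .free + kindSeries .used) := by
  simp only [coeff_vcSeries, map_add, coeff_rootedSeries]
  rw [← mul_div_assoc, ← add_div, ← add_div]
  congr 1
  exact_mod_cast mul_numMinVertexCovers n

/-- Coefficientwise this is 2 = 2n - 2(n - 1): vertices minus edges, each edge counted with both
orientations. -/
lemma two_mul_vcSeries : 2 * vcSeries =
    2 * (kindSeries .tight + kindSeries .free + kindSeries .used) -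
      (edgeRootedSeries .tight (fun _ => True) + edgeRootedSeries .free (fun _ => True) +
        edgeRootedSeries .used fun _ => True) := by
  ext n
  have h1 := natCast_mul_coeff_vcSeries n
  have h2 : 2 * ((n : ℚ) - 1) * coeff n vcSeries =
      coeff n (edgeRootedSeries .tight (fun _ => True) + edgeRootedSeries .free (fun _ => True) +
        edgeRootedSeries .used fun _ => True) := by
    rcases Nat.eq_zero_or_pos n with rfl | hn
    -- For `n = 0` the truncated `n - 1` is not the rational one, but all coefficients vanish.
    · simp [vcSeries, edgeRootedSeries, egf]
    · simp only [coeff_vcSeries, map_add, coeff_edgeRootedSeries]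
      rw [← mul_div_assoc, ← add_div, ← add_div]
      congr 1
      have := two_mul_numMinVertexCovers n
      rw [← Nat.cast_one, ← Nat.cast_sub hn]
      exact_mod_cast this
  have h3 : ∀ f : ℚ⟦X⟧, coeff n (2 * f) = 2 * coeff n f := fun f => by
    rw [two_mul, map_add, two_mul]
  rw [map_sub, h3, h3, ← h1, ← h2]
  ring

end TreeVertexCovers

namespace TreeVertexCovers

/-! ### Exponentials of power series -/

section Exp

variable {a b : ℚ⟦X⟧}

lemma coeff_pow_eq_zero (ha : constantCoeff a = 0) {n d : ℕ} (h : n < d) : coeff n (a ^ d) = 0 :=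
  X_pow_dvd_iff.1 (pow_dvd_pow_of_dvd (X_dvd_iff.2 ha) d) n h

lemma coeff_expOf (ha : constantCoeff a = 0) {n N : ℕ} (hN : n < N) :
    coeff n (expOf a) = ∑ d ∈ Finset.range N, (1 / d.factorial : ℚ) * coeff n (a ^ d) := by
  rw [expOf, coeff_subst' (.of_constantCoeff_zero' ha),
    finsum_eq_sum_of_support_subset (s := Finset.range N)]
  · simp [coeff_exp]
  · intro d hd
    simp only [Finset.coe_range, Set.mem_Iio]
    by_contra h
    exact hd (by simp [coeff_pow_eq_zero ha (show n < d by omega)])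

@[simp] lemma constantCoeff_expOf (ha : constantCoeff a = 0) : constantCoeff (expOf a) = 1 := by
  rw [← coeff_zero_eq_constantCoeff_apply, coeff_expOf ha zero_lt_one]
  simp

lemma derivative_expOf (ha : constantCoeff a = 0) :
    derivative ℚ (expOf a) = derivative ℚ a * expOf a := by
  rw [expOf, derivative_subst (.of_constantCoeff_zero' ha), derivative_exp, mul_comm]

/-- The quotient of `f` by `expOf a` has derivative zero and constant term one. -/
lemma eq_expOf_of_derivative {f : ℚ⟦X⟧} (ha : constantCoeff a = 0) (hf : constantCoeff f = 1)
    (h : derivative ℚ f = derivative ℚ a * f) : f = expOf a := by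
  have hne : constantCoeff (expOf a) ≠ 0 := by rw [constantCoeff_expOf ha]; exact one_ne_zero
  have hE : expOf a * (expOf a)⁻¹ = 1 := PowerSeries.mul_inv_cancel _ hne
  have h1 : f * (expOf a)⁻¹ = 1 := by
    refine derivative.ext ?_ ?_
    · rw [Derivation.leibniz, derivative_inv', h, derivative_expOf ha, derivative_one]
      simp only [smul_eq_mul]
      linear_combination (- f * derivative ℚ a * (expOf a)⁻¹) * hE
    · simp [hf, constantCoeff_expOf ha]
  linear_combination expOf a * h1 - f * hE

lemma expOf_add (ha : constantCoeff a = 0) (hb : constantCoeff b = 0) :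
    expOf (a + b) = expOf a * expOf b := by
  refine (eq_expOf_of_derivative (by simp [ha, hb])
    (by simp [constantCoeff_expOf ha, constantCoeff_expOf hb]) ?_).symm
  rw [Derivation.leibniz, derivative_expOf ha, derivative_expOf hb, map_add]
  simp only [smul_eq_mul]
  ring

lemma dvd_expOf_sub_one (ha : constantCoeff a = 0) : a ∣ expOf a - 1 := by
  obtain ⟨g, hg⟩ : (X : ℚ⟦X⟧) ∣ exp ℚ - 1 := X_dvd_iff.2 (by simp)
  have hs : HasSubst a := .of_constantCoeff_zero' ha
  refine ⟨g.subst a, ?_⟩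
  have := congrArg (subst a) hg
  rw [subst_mul hs, subst_X hs, subst_sub hs] at this
  rw [← this, expOf]
  congr 1
  rw [← coe_substAlgHom hs, map_one]

/-- Divisibility by the difference plays the role of a Lipschitz estimate in the uniqueness proofs.
-/
lemma sub_dvd_expOf_sub (ha : constantCoeff a = 0) (hb : constantCoeff b = 0) :
    a - b ∣ expOf a - expOf b := by
  have h1 : constantCoeff (a - b) = 0 := by simp [ha, hb]
  have h2 := expOf_add hb h1
  rw [add_sub_cancel] at h2
  rw [h2, show expOf b * expOf (a - b) - expOf b = expOf b * (expOf (a - b) - 1) by ring]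
  exact (dvd_expOf_sub_one h1).mul_left _

/-- A sum over the degree of the root is an exponential. -/
lemma eq_mul_expOf {K : ℕ → ℚ⟦X⟧} {R : ℚ⟦X⟧} (ha : constantCoeff a = 0) (h0 : K 0 = b)
    (hK : ∀ d : ℕ, ((d : ℚ) + 1) • K (d + 1) = K d * a)
    (hR : ∀ n, coeff n R = ∑ d ∈ Finset.range (n + 1), coeff n (K d)) : R = b * expOf a := by
  have hK' : ∀ d : ℕ, K d = (1 / d.factorial : ℚ) • (b * a ^ d) := by
    intro d
    induction d with
    | zero => simp [h0]
    | succ d ih =>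
      have hd : (d : ℚ) + 1 ≠ 0 := by positivity
      have h1 : K (d + 1) = ((d : ℚ) + 1)⁻¹ • (K d * a) := by
        rw [← hK, smul_smul, inv_mul_cancel₀ hd, one_smul]
      rw [h1, ih, smul_mul_assoc, smul_smul, Nat.factorial_succ, pow_succ, mul_assoc]
      congr 1
      push_cast
      field_simp
  ext n
  rw [hR, coeff_mul]
  simp only [hK', map_smul, coeff_mul, smul_eq_mul, Finset.mul_sum]
  rw [Finset.sum_comm]
  refine Finset.sum_congr rfl fun x hx => ?_
  have : x.2 < n + 1 := by have := Finset.HasAntidiagonal.mem_antidiagonal.1 hx; omega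
  rw [coeff_expOf ha this, Finset.mul_sum]
  refine Finset.sum_congr rfl fun d _ => by ring

end Exp

/-! ### The tree function -/

section TreeSeries

/-- The `M`-th finite difference of t^(M-1) at 0 vanishes. The term `m = 0`, absent here, is nonzero
only for `M = 1`, where 0^0 = 1. -/
lemma sum_Icc_choose_mul_pow (M : ℕ) : ∑ m ∈ Finset.Icc 1 M,
    (M.choose m : ℚ) * (-1) ^ (M - m) * (m : ℚ) ^ (M - 1) = if M = 1 then 1 else 0 := by
  rcases Nat.eq_zero_or_pos M with rfl | hM
  · simp
  have h := congrFun (fwdDiff_iter_pow_eq_zero_of_lt (R := ℚ) (show M - 1 < M by omega)) 0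
  rw [fwdDiff_iter_eq_sum_shift, Finset.range_eq_Ico, Finset.sum_eq_sum_Ico_succ_bot (by omega)] at h
  have h2 : Finset.Ico (0 + 1) (M + 1) = Finset.Icc 1 M := rfl
  rw [h2] at h
  have h3 : ∑ m ∈ Finset.Icc 1 M, (M.choose m : ℚ) * (-1) ^ (M - m) * (m : ℚ) ^ (M - 1) =
      - ((-1) ^ M * (0 : ℚ) ^ (M - 1)) := by
    rw [eq_neg_iff_add_eq_zero, add_comm]
    have h4 : ∀ m : ℕ, (M.choose m : ℚ) * (-1) ^ (M - m) * (m : ℚ) ^ (M - 1) =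
        ((-1 : ℤ) ^ (M - m) * (M.choose m : ℤ)) • ((0 : ℚ) + m • 1) ^ (M - 1) := fun m => by
      simp only [zsmul_eq_mul, nsmul_eq_mul, mul_one, zero_add]
      push_cast
      ring
    simp only [h4]
    simpa using h
  rw [h3]
  split_ifs with h1
  · simp [h1]
  · rw [zero_pow (by omega)]; simp

/-- An instance of Abel's binomial theorem. -/
lemma sum_choose_mul_pow_mul_pow {n : ℕ} (hn : n ≠ 0) : ∑ m ∈ Finset.Icc 1 n,
    (n.choose m : ℚ) * (m : ℚ) ^ (m - 1) * ((n - m : ℕ) : ℚ) ^ (n - m) = (n : ℚ) ^ n := by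
  have h1 : ∀ m ∈ Finset.Icc 1 n,
      (n.choose m : ℚ) * (m : ℚ) ^ (m - 1) * ((n - m : ℕ) : ℚ) ^ (n - m) =
      ∑ j ∈ Finset.range (n - m + 1), (n : ℚ) ^ j * n.choose j *
        (((n - j).choose m : ℚ) * (-1) ^ (n - j - m) * (m : ℚ) ^ (n - j - 1)) := by
    intro m hm
    rw [Finset.mem_Icc] at hm
    -- Expanding (n + (-m))^(n-m) and exchanging the sums leaves, for each `j`, the preceding
    -- alternating sum with `M = n - j`; only `j = n - 1` survives.
    rw [Nat.cast_sub hm.2, sub_eq_add_neg, add_pow, Finset.mul_sum]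
    refine Finset.sum_congr rfl fun j hj => ?_
    have hj' : j ≤ n - m := Nat.lt_succ_iff.1 (Finset.mem_range.1 hj)
    have hc : (n.choose m : ℚ) * ((n - m).choose j : ℚ) =
        (n.choose j : ℚ) * ((n - j).choose m : ℚ) := by
      have := Nat.choose_mul (n := n) hj'
      rw [Nat.choose_symm hm.2, show n - m - j = n - j - m by omega,
        Nat.choose_symm (by omega)] at this
      exact_mod_cast this
    have hp : (m : ℚ) ^ (n - j - 1) = (m : ℚ) ^ (m - 1) * (m : ℚ) ^ (n - m - j) := by
      rw [← pow_add]; congr 1; omega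
    rw [hp, neg_pow (m : ℚ), show n - j - m = n - m - j by omega]
    linear_combination ((m : ℚ) ^ (m - 1) * (n : ℚ) ^ j * (-1) ^ (n - m - j) *
      (m : ℚ) ^ (n - m - j)) * hc
  rw [Finset.sum_congr rfl h1, Finset.sum_comm' (t' := Finset.range n)
    (s' := fun j => Finset.Icc 1 (n - j))]
  · simp only [← Finset.mul_sum, sum_Icc_choose_mul_pow]
    rw [Finset.sum_eq_single (n - 1)]
    · rw [if_pos (by omega), mul_one, Nat.choose_symm (by omega : 1 ≤ n), Nat.choose_one_right,
        ← pow_succ, Nat.sub_add_cancel (by omega)]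
    · intro j hj hne
      rw [Finset.mem_range] at hj
      rw [if_neg (by omega), mul_zero]
    · intro h
      exact absurd (Finset.mem_range.2 (by omega)) h
  · intro m j
    simp only [Finset.mem_Icc, Finset.mem_range]
    omega

lemma coeff_treeSeries (n : ℕ) :
    coeff n treeSeries = if n = 0 then 0 else (n : ℚ) ^ (n - 1) / n.factorial := by
  simp [treeSeries, egf]

lemma constantCoeff_treeSeries : constantCoeff treeSeries = 0 := by
  rw [← coeff_zero_eq_constantCoeff_apply, coeff_treeSeries, if_pos rfl]

/-- Since 1 + x T' is the series of n^n / n!, comparing coefficients gives exactly the Abel identity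
above. -/
lemma X_mul_derivative_treeSeries :
    X * derivative ℚ treeSeries = treeSeries * (1 + X * derivative ℚ treeSeries) := by
  have hq : ∀ n, coeff n (1 + X * derivative ℚ treeSeries) = (n : ℚ) ^ n / n.factorial := by
    intro n
    cases n with
    | zero => simp
    | succ n =>
      rw [map_add, coeff_succ_X_mul, coeff_derivative, coeff_treeSeries, if_neg n.succ_ne_zero,
        coeff_one, if_neg n.succ_ne_zero, Nat.add_sub_cancel, pow_succ]
      push_cast; ring
  ext n
  rcases Nat.eq_zero_or_pos n with rfl | hn
  · simp [constantCoeff_treeSeries]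
  have h0 : coeff n (X * derivative ℚ treeSeries) = (n : ℚ) ^ n / n.factorial := by
    rw [← hq n, map_add, coeff_one, if_neg hn.ne', zero_add]
  rw [h0, coeff_mul, ← sum_choose_mul_pow_mul_pow hn.ne',
    Finset.Nat.sum_antidiagonal_eq_sum_range_succ_mk, Finset.range_eq_Ico,
    Finset.sum_eq_sum_Ico_succ_bot (by omega), coeff_zero_eq_constantCoeff_apply, constantCoeff_treeSeries,
    zero_mul, zero_add, Finset.sum_div]
  refine Finset.sum_congr rfl fun m hm => ?_
  obtain ⟨h1, h2⟩ : 1 ≤ m ∧ m ≤ n := Finset.mem_Icc.1 hm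
  have hf : (n.factorial : ℚ) ≠ 0 := by positivity
  rw [hq, coeff_treeSeries, if_neg (by omega), Nat.cast_choose ℚ h2]
  field_simp

/-- The series y = T e^(-T) satisfies x y' = y, which leaves only its linear coefficient. -/
lemma treeSeries_eq : treeSeries = X * expOf treeSeries := by
  have hT := constantCoeff_treeSeries
  have hT' : constantCoeff (-treeSeries) = 0 := by simp [hT]
  have hE : expOf treeSeries * expOf (-treeSeries) = 1 := by
    rw [← expOf_add hT hT', add_neg_cancel]
    exact (eq_expOf_of_derivative (by simp) (by simp) (by simp)).symm
  suffices h : treeSeries * expOf (-treeSeries) = X by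
    linear_combination expOf treeSeries * h - treeSeries * hE
  have hd : X * derivative ℚ (treeSeries * expOf (-treeSeries)) =
      treeSeries * expOf (-treeSeries) := by
    rw [Derivation.leibniz, derivative_expOf hT', map_neg]
    simp only [smul_eq_mul]
    linear_combination expOf (-treeSeries) * X_mul_derivative_treeSeries
  ext n
  rcases n with _ | n
  · simp [hT]
  have h1 := congrArg (coeff (n + 1)) hd
  rw [coeff_succ_X_mul, coeff_derivative] at h1
  rw [coeff_X]
  split_ifs with h
  · obtain rfl : n = 0 := by omega
    rw [coeff_mul]
    simp [Finset.Nat.antidiagonal_succ, coeff_treeSeries,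
      constantCoeff_expOf hT']
  · have hn : (n : ℚ) ≠ 0 := by
      rw [Nat.cast_ne_zero]; omega
    have : (n : ℚ) * coeff (n + 1) (treeSeries * expOf (-treeSeries)) = 0 := by
      linear_combination h1
    exact (mul_eq_zero.1 this).resolve_left hn

variable {w z : ℚ⟦X⟧}

lemma constantCoeff_treeOf (hw : constantCoeff w = 0) : constantCoeff (treeOf w) = 0 :=
  constantCoeff_subst_eq_zero hw _ constantCoeff_treeSeries

lemma treeOf_eq (hw : constantCoeff w = 0) : treeOf w = w * expOf (treeOf w) := by
  have hs : HasSubst w := .of_constantCoeff_zero' hw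
  have h := congrArg (subst w) treeSeries_eq
  rw [subst_mul hs, subst_X hs, expOf,
    subst_comp_subst_apply (.of_constantCoeff_zero' constantCoeff_treeSeries) hs] at h
  exact h

/-- Subtracting the two fixed point equations leaves u - v times a unit. With `w = z` this is
uniqueness of the fixed point; in general it bounds the change of T. -/
lemma sub_dvd_treeOf_sub (hz : constantCoeff z = 0) {u v : ℚ⟦X⟧}
    (hu : constantCoeff u = 0) (hv : constantCoeff v = 0)
    (huw : u = w * expOf u) (hvz : v = z * expOf v) : w - z ∣ u - v := by
  obtain ⟨h, hh⟩ := sub_dvd_expOf_sub hu hv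
  have h1 : (u - v) * (1 - z * h) = (w - z) * expOf u := by
    linear_combination huw - hvz + z * hh
  have h2 : IsUnit (1 - z * h) := by
    rw [isUnit_iff_constantCoeff]; simp [hz]
  rw [← h2.dvd_mul_right, h1]
  exact dvd_mul_right _ _

lemma eq_treeOf (hw : constantCoeff w = 0) {u : ℚ⟦X⟧} (hu : constantCoeff u = 0)
    (huw : u = w * expOf u) : u = treeOf w := by
  have := sub_dvd_treeOf_sub hw hu (constantCoeff_treeOf hw) huw (treeOf_eq hw)
  rw [sub_self, zero_dvd_iff] at this
  exact sub_eq_zero.1 this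

end TreeSeries

/-! ### The implicit equation -/

section Implicit

variable {U V : ℚ⟦X⟧}

lemma expOf_two_mul (hU : constantCoeff U = 0) : X ^ 2 * expOf (2 * U) = (X * expOf U) ^ 2 := by
  rw [two_mul, expOf_add hU hU]; ring

/-- Inserting T(w) = w e^T(w) with w = (x e^U)^2 allows a factor x e^U to be cancelled. The
remaining explicit factor x makes the equation contracting. -/
lemma isImplicitSolution_iff : IsImplicitSolution U ↔ constantCoeff U = 0 ∧
    U = X * (expOf U * expOf (treeOf ((X * expOf U) ^ 2)) * (expOf (X * expOf U) - 1)) := by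
  refine and_congr_right fun hU => ?_
  have hne : X * expOf U ≠ 0 := by
    refine mul_ne_zero X_ne_zero fun h => ?_
    have := constantCoeff_expOf hU
    rw [h] at this
    simp at this
  have hT := treeOf_eq (w := (X * expOf U) ^ 2) (by simp)
  rw [expOf_two_mul hU]
  constructor <;> intro h
  · refine mul_left_cancel₀ hne ?_
    linear_combination h + (expOf (X * expOf U) - 1) * hT
  · linear_combination X * expOf U * h - (expOf (X * expOf U) - 1) * hT

lemma IsImplicitSolution.eq (hU : IsImplicitSolution U) (hV : IsImplicitSolution V) : U = V := by
  rw [isImplicitSolution_iff] at hU hV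
  obtain ⟨hU0, hU⟩ := hU
  obtain ⟨hV0, hV⟩ := hV
  obtain ⟨a, ha⟩ := sub_dvd_expOf_sub hU0 hV0
  obtain ⟨b, hb⟩ := sub_dvd_treeOf_sub (w := (X * expOf U) ^ 2) (z := (X * expOf V) ^ 2)
    (by simp) (constantCoeff_treeOf (by simp)) (constantCoeff_treeOf (by simp))
    (treeOf_eq (by simp)) (treeOf_eq (by simp))
  obtain ⟨c, hc⟩ := sub_dvd_expOf_sub (a := treeOf ((X * expOf U) ^ 2))
    (b := treeOf ((X * expOf V) ^ 2)) (constantCoeff_treeOf (by simp))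
    (constantCoeff_treeOf (by simp))
  obtain ⟨d, hd⟩ := sub_dvd_expOf_sub (a := X * expOf U) (b := X * expOf V) (by simp) (by simp)
  set P := expOf U
  set Q := expOf V
  set S := treeOf ((X * P) ^ 2)
  set T := treeOf ((X * Q) ^ 2)
  have hST : S - T = (U - V) * (X ^ 2 * a * (P + Q) * b) := by
    linear_combination hb + X ^ 2 * (P + Q) * b * ha
  -- The product on the right side of the equation is changed from U to V one factor at a time; the
  -- cofactor of U - V has constant term one.
  have h : (U - V) * (1 - X * (a * expOf S * (expOf (X * P) - 1) +
      Q * (X ^ 2 * a * (P + Q) * b * c) * (expOf (X * P) - 1) +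
      Q * expOf T * (X * a * d))) = 0 := by
    linear_combination hU - hV + X * expOf S * (expOf (X * P) - 1) * ha +
      X * Q * (expOf (X * P) - 1) * (hc + c * hST) + X * Q * expOf T * (hd + X * d * ha)
  refine sub_eq_zero.1 ((mul_eq_zero.1 h).resolve_right fun h0 => ?_)
  have := congrArg constantCoeff h0
  simp at this

end Implicit

/-! ### Solving the system for the kinds -/

section System

lemma constantCoeff_kindSeries (k : Kind) : constantCoeff (kindSeries k) = 0 := by
  simp [kindSeries, rootedSeries, egf, ← coeff_zero_eq_constantCoeff_apply]

lemma kindSeries_free : kindSeries .free = X * expOf (kindSeries .tight) := by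
  refine eq_mul_expOf (constantCoeff_kindSeries _) (K := fun d => rootedSeries .free (· = d))
    (by simp [rootedSeries_degree_zero]) (fun d => ?_) fun n => coeff_kindSeries _ n.le_succ
  rw [succ_smul_rootedSeries, edgeRootedSeries_free]

lemma kindSeries_pending :
    kindSeries .pending = X * expOf (kindSeries .tight + kindSeries .used) := by
  refine eq_mul_expOf (by simp [constantCoeff_kindSeries])
    (K := fun d => rootedSeries .pending (· = d))
    (by simp [rootedSeries_degree_zero]) (fun d => ?_) fun n => coeff_kindSeries _ n.le_succ
  rw [succ_smul_rootedSeries, edgeRootedSeries_pending]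

/-- With the root in the cover, children may be tight, free or used, and a free child turns pending
into tight. The sum of both kinds therefore has a recursion of exponential type, which tight alone
has not. -/
lemma kindSeries_pending_add_tight : kindSeries .pending + kindSeries .tight =
    X * expOf (kindSeries .tight + kindSeries .free + kindSeries .used) := by
  refine eq_mul_expOf (by simp [constantCoeff_kindSeries])
    (K := fun d => rootedSeries .pending (· = d) + rootedSeries .tight (· = d))
    (by simp [rootedSeries_degree_zero]) (fun d => ?_) fun n => ?_
  · rw [smul_add, succ_smul_rootedSeries, succ_smul_rootedSeries, edgeRootedSeries_pending,
      edgeRootedSeries_tight]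
    ring
  · simp only [map_add, Finset.sum_add_distrib, ← coeff_kindSeries _ n.le_succ]

/-- A used root has exactly one pending child, and its other children are tight; without the pending
child the root is free. -/
lemma rootedSeries_used_succ (d : ℕ) : rootedSeries .used (· = d + 1) =
    rootedSeries .free (· = d) * kindSeries .pending := by
  have hd : ∀ d : ℕ, (d : ℚ) + 1 ≠ 0 := fun d => by positivity
  induction d with
  | zero =>
    have := succ_smul_rootedSeries .used 0
    rw [edgeRootedSeries_used, rootedSeries_degree_zero .used] at this
    simpa using this
  | succ d ih =>
    have h1 := succ_smul_rootedSeries .used (d + 1)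
    have h2 := succ_smul_rootedSeries .free d
    rw [edgeRootedSeries_used, ih] at h1
    rw [edgeRootedSeries_free] at h2
    refine smul_right_injective _ (hd (d + 1)) ?_
    simp only [h1]
    rw [mul_right_comm, ← h2]
    push_cast
    rw [add_smul ((d : ℚ) + 1), one_smul, smul_mul_assoc]

lemma kindSeries_used : kindSeries .used = kindSeries .free * kindSeries .pending := by
  ext n
  rw [coeff_kindSeries .used (show n ≤ n + 1 + 1 by omega), Finset.sum_range_succ', coeff_mul,
    rootedSeries_degree_zero .used]
  simp only [rootedSeries_used_succ, coeff_mul]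
  rw [Finset.sum_comm]
  simp only [← Finset.sum_mul]
  simp only [reduceCtorEq, or_self, if_false, map_zero, add_zero]
  refine Finset.sum_congr rfl fun x hx => ?_
  rw [coeff_kindSeries .free (show x.1 ≤ n + 1 from by have := Finset.HasAntidiagonal.mem_antidiagonal.1 hx; omega)]

lemma kindSeries_used_eq_treeOf :
    kindSeries .used = treeOf (X ^ 2 * expOf (2 * kindSeries .tight)) := by
  have hU := constantCoeff_kindSeries .tight
  have hW := constantCoeff_kindSeries .used
  refine eq_treeOf (by simp) hW ?_
  rw [expOf_two_mul hU]
  conv_lhs => rw [kindSeries_used, kindSeries_pending, expOf_add hU hW, kindSeries_free]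
  ring

/-- The exponential formulas give P + U = P e^F; multiply by F and use W = F P. -/
lemma isImplicitSolution_kindSeries : IsImplicitSolution (kindSeries .tight) := by
  have hU := constantCoeff_kindSeries .tight
  have hW := constantCoeff_kindSeries .used
  have hF := constantCoeff_kindSeries .free
  refine ⟨hU, ?_⟩
  rw [← kindSeries_used_eq_treeOf, ← kindSeries_free]
  have h1 := kindSeries_pending_add_tight
  have h2 := kindSeries_pending
  rw [add_right_comm, expOf_add (by simp [hU, hW]) hF] at h1
  rw [mul_right_comm, ← kindSeries_free, kindSeries_used]
  linear_combination kindSeries .free * (h1 - expOf (kindSeries .free) * h2)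

lemma vcSeries_eq : vcSeries =
    (1 - kindSeries .tight) * X * expOf (kindSeries .tight) -
      kindSeries .tight * treeOf (X ^ 2 * expOf (2 * kindSeries .tight)) +
      kindSeries .tight - (1 / 2 : ℚ) • kindSeries .tight ^ 2 := by
  have h2 : (2 : ℚ⟦X⟧) ≠ 0 := fun h => by
    have := congrArg constantCoeff h
    rw [map_ofNat, map_zero] at this
    exact two_ne_zero this
  have hs : 2 * ((1 / 2 : ℚ) • kindSeries .tight ^ 2) = kindSeries .tight ^ 2 := by
    rw [two_mul, ← add_smul]; norm_num
  refine mul_left_cancel₀ h2 ?_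
  rw [two_mul_vcSeries, edgeRootedSeries_tight, edgeRootedSeries_free, edgeRootedSeries_used,
    ← kindSeries_used_eq_treeOf]
  linear_combination hs + 2 * (1 - kindSeries .tight) * kindSeries_free + 2 * kindSeries_used

end System

end TreeVertexCovers

namespace TreeVertexCovers

/-! ### The first ten values -/

/-- Coefficient comparison in (e^a)' = a' e^a, shifted by the factor x; it involves only earlier
coefficients. -/
lemma coeff_X_mul_expOf_succ {a f : ℚ⟦X⟧} (ha : constantCoeff a = 0) (hf : f = X * expOf a)
    (m : ℕ) : coeff (m + 2) f =
      (∑ i ∈ Finset.range (m + 1), ((i : ℚ) + 1) * coeff (i + 1) a * coeff (m - i + 1) f) /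
        (m + 1) := by
  have h := congrArg (coeff m) (derivative_expOf ha)
  rw [coeff_derivative, coeff_mul, Finset.Nat.sum_antidiagonal_eq_sum_range_succ_mk] at h
  simp only [hf, coeff_succ_X_mul]
  have hm : (m : ℚ) + 1 ≠ 0 := by positivity
  rw [eq_div_iff hm, h]
  refine Finset.sum_congr rfl fun i _ => ?_
  rw [coeff_derivative]
  ring

lemma coeff_one_X_mul_expOf {a f : ℚ⟦X⟧} (ha : constantCoeff a = 0) (hf : f = X * expOf a) :
    coeff 1 f = 1 := by
  rw [hf, show 1 = 0 + 1 from rfl, coeff_succ_X_mul, coeff_zero_eq_constantCoeff_apply,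
    constantCoeff_expOf ha]

lemma coeff_mul_add_two {a b : ℚ⟦X⟧} (ha : constantCoeff a = 0) (hb : constantCoeff b = 0) (m : ℕ) :
    coeff (m + 2) (a * b) =
      ∑ i ∈ Finset.range (m + 1), coeff (i + 1) a * coeff (m - i + 1) b := by
  rw [coeff_mul, Finset.Nat.sum_antidiagonal_eq_sum_range_succ_mk, Finset.sum_range_succ,
    Finset.sum_range_succ']
  simp only [Nat.sub_self, coeff_zero_eq_constantCoeff_apply, ha, hb, zero_mul, mul_zero, add_zero]
  refine Finset.sum_congr rfl fun i hi => ?_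
  have := Finset.mem_range.1 hi
  rw [show m + 2 - (i + 1) = m - i + 1 by omega]

/-- The values determined by the recurrences for the coefficients of the four kinds. -/
lemma values_of_recurrence {w d s q : ℕ → ℚ} (hw0 : w 0 = 1) (hd0 : d 0 = 1) (hs0 : s 0 = 1)
    (hq0 : q 0 = 0)
    (hw : ∀ m : ℕ, w (m + 1) =
      (∑ i ∈ Finset.range (m + 1), ((i : ℚ) + 1) * (s i - d i) * w (m - i)) / (m + 1))
    (hd : ∀ m : ℕ, d (m + 1) =
      (∑ i ∈ Finset.range (m + 1), ((i : ℚ) + 1) * (s i - d i + q i) * d (m - i)) / (m + 1))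
    (hs : ∀ m : ℕ, s (m + 1) =
      (∑ i ∈ Finset.range (m + 1), ((i : ℚ) + 1) * (s i - d i + w i + q i) * s (m - i)) / (m + 1))
    (hq : ∀ m : ℕ, q (m + 1) = ∑ i ∈ Finset.range (m + 1), w i * d (m - i)) :
    (List.range 10).map (fun m => (m.factorial : ℚ) * (s m - d m + w m + q m)) =
      [1, 2, 3, 40, 185, 3936, 35917, 978160, 14301513, 464105440] := by
  obtain ⟨hw1, hd1, hs1, hq1⟩ : w 1 = 0 ∧ d 1 = 0 ∧ s 1 = 1 ∧
      q 1 = 1 := by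
    refine ⟨?_, ?_, ?_, ?_⟩ <;> simp only [hw 0, hd 0, hs 0, hq 0, Finset.sum_range_succ,
      Finset.sum_range_zero, Nat.reduceSub, hw0, hd0, hs0, hq0] <;> norm_num
  obtain ⟨hw2, hd2, hs2, hq2⟩ : w 2 = 1 ∧ d 2 = 2 ∧ s 2 = 5/2 ∧
      q 2 = 0 := by
    refine ⟨?_, ?_, ?_, ?_⟩ <;> simp only [hw 1, hd 1, hs 1, hq 1, Finset.sum_range_succ,
      Finset.sum_range_zero, Nat.reduceSub, hw0, hd0, hs0, hq0, hw1, hd1, hs1, hq1] <;> norm_num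
  obtain ⟨hw3, hd3, hs3, hq3⟩ : w 3 = 1/2 ∧ d 3 = 1/2 ∧ s 3 = 11/3 ∧
      q 3 = 3 := by
    refine ⟨?_, ?_, ?_, ?_⟩ <;> simp only [hw 2, hd 2, hs 2, hq 2, Finset.sum_range_succ,
      Finset.sum_range_zero, Nat.reduceSub, hw0, hd0, hs0, hq0, hw1, hd1, hs1, hq1, hw2, hd2, hs2,
      hq2] <;> norm_num
  obtain ⟨hw4, hd4, hs4, hq4⟩ : w 4 = 11/3 ∧ d 4 = 49/6 ∧ s 4 = 269/24 ∧
      q 4 = 1 := by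
    refine ⟨?_, ?_, ?_, ?_⟩ <;> simp only [hw 3, hd 3, hs 3, hq 3, Finset.sum_range_succ,
      Finset.sum_range_zero, Nat.reduceSub, hw0, hd0, hs0, hq0, hw1, hd1, hs1, hq1, hw2, hd2, hs2,
      hq2, hw3, hd3, hs3, hq3] <;> norm_num
  obtain ⟨hw5, hd5, hs5, hq5⟩ : w 5 = 85/24 ∧ d 5 = 121/24 ∧ s 5 = 307/15 ∧
      q 5 = 83/6 := by
    refine ⟨?_, ?_, ?_, ?_⟩ <;> simp only [hw 4, hd 4, hs 4, hq 4, Finset.sum_range_succ,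
      Finset.sum_range_zero, Nat.reduceSub, hw0, hd0, hs0, hq0, hw1, hd1, hs1, hq1, hw2, hd2, hs2,
      hq2, hw3, hd3, hs3, hq3, hw4, hd4, hs4, hq4] <;> norm_num
  obtain ⟨hw6, hd6, hs6, hq6⟩ : w 6 = 1133/60 ∧ d 6 = 861/20 ∧ s 6 = 46057/720 ∧
      q 6 = 121/12 := by
    refine ⟨?_, ?_, ?_, ?_⟩ <;> simp only [hw 5, hd 5, hs 5, hq 5, Finset.sum_range_succ,
      Finset.sum_range_zero, Nat.reduceSub, hw0, hd0, hs0, hq0, hw1, hd1, hs1, hq1, hw2, hd2, hs2,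
      hq2, hw3, hd3, hs3, hq3, hw4, hd4, hs4, hq4, hw5, hd5, hs5, hq5] <;> norm_num
  obtain ⟨hw7, hd7, hs7, hq7⟩ : w 7 = 18571/720 ∧ d 7 = 31081/720 ∧ s 7 = 337103/2520 ∧
      q 7 = 4661/60 := by
    refine ⟨?_, ?_, ?_, ?_⟩ <;> simp only [hw 6, hd 6, hs 6, hq 6, Finset.sum_range_succ,
      Finset.sum_range_zero, Nat.reduceSub, hw0, hd0, hs0, hq0, hw1, hd1, hs1, hq1, hw2, hd2, hs2,
      hq2, hw3, hd3, hs3, hq3, hw4, hd4, hs4, hq4, hw5, hd5, hs5, hq5, hw6, hd6, hs6, hq6] <;>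
      norm_num
  obtain ⟨hw8, hd8, hs8, hq8⟩ : w 8 = 72017/630 ∧ d 8 = 657941/2520 ∧ s 8 = 16711529/40320 ∧
      q 8 = 31321/360 := by
    refine ⟨?_, ?_, ?_, ?_⟩ <;> simp only [hw 7, hd 7, hs 7, hq 7, Finset.sum_range_succ,
      Finset.sum_range_zero, Nat.reduceSub, hw0, hd0, hs0, hq0, hw1, hd1, hs1, hq1, hw2, hd2, hs2,
      hq2, hw3, hd3, hs3, hq3, hw4, hd4, hs4, hq4, hw5, hd5, hs5, hq5, hw6, hd6, hs6, hq6, hw7,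
      hd7, hs7, hq7] <;> norm_num
  obtain ⟨hw9, hd9, hs9, hq9⟩ : w 9 = 872953/4480 ∧ d 9 = 319765/896 ∧ s 9 = 21557839/22680 ∧
      q 9 = 617971/1260 := by
    refine ⟨?_, ?_, ?_, ?_⟩ <;> simp only [hw 8, hd 8, hs 8, hq 8, Finset.sum_range_succ,
      Finset.sum_range_zero, Nat.reduceSub, hw0, hd0, hs0, hq0, hw1, hd1, hs1, hq1, hw2, hd2, hs2,
      hq2, hw3, hd3, hs3, hq3, hw4, hd4, hs4, hq4, hw5, hd5, hs5, hq5, hw6, hd6, hs6, hq6, hw7,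
      hd7, hs7, hq7, hw8, hd8, hs8, hq8] <;> norm_num
  simp only [List.range, List.range.loop, List.map_cons, List.map_nil, hw0, hd0, hs0, hq0, hw1,
    hd1, hs1, hq1, hw2, hd2, hs2, hq2, hw3, hd3, hs3, hq3, hw4, hd4, hs4, hq4, hw5, hd5, hs5, hq5,
    hw6, hd6, hs6, hq6, hw7, hd7, hs7, hq7, hw8, hd8, hs8, hq8, hw9, hd9, hs9, hq9]
  norm_num [Nat.factorial]

lemma map_numMinVertexCovers : (List.range 10).map (fun i => numMinVertexCovers (i + 1)) =
    [1, 2, 3, 40, 185, 3936, 35917, 978160, 14301513, 464105440] := by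
  have hU := constantCoeff_kindSeries .tight
  have hW := constantCoeff_kindSeries .used
  have hF := constantCoeff_kindSeries .free
  have hP := constantCoeff_kindSeries .pending
  have hUW : constantCoeff (kindSeries .tight + kindSeries .used) = 0 := by simp [hU, hW]
  have hUFW : constantCoeff (kindSeries .tight + kindSeries .free + kindSeries .used) = 0 := by
    simp [hU, hF, hW]
  have hval : ∀ i : ℕ, (numMinVertexCovers (i + 1) : ℚ) = (i.factorial : ℚ) *
      coeff (i + 1) (kindSeries .tight + kindSeries .free + kindSeries .used) := fun i => by
    have h := natCast_mul_coeff_vcSeries (i + 1)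
    have hi : (i.factorial : ℚ) ≠ 0 := by positivity
    have hi' : ((i + 1 : ℕ) : ℚ) ≠ 0 := by positivity
    rw [← h, coeff_vcSeries, Nat.factorial_succ]
    push_cast at hi' ⊢
    field_simp
  -- Index `m` stands for the coefficient of x^(m+1). Since `s` belongs to pending plus tight, `s -
  -- d` belongs to tight.
  have key := values_of_recurrence
    (w := fun m => coeff (m + 1) (kindSeries .free))
    (d := fun m => coeff (m + 1) (kindSeries .pending))
    (s := fun m => coeff (m + 1) (kindSeries .pending + kindSeries .tight))
    (q := fun m => coeff (m + 1) (kindSeries .used))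
    (coeff_one_X_mul_expOf hU kindSeries_free) (coeff_one_X_mul_expOf hUW kindSeries_pending)
    (coeff_one_X_mul_expOf hUFW kindSeries_pending_add_tight)
    (by rw [kindSeries_used, kindSeries_free, mul_assoc, coeff_succ_X_mul]; simp [hP])
    (fun m => by simpa using coeff_X_mul_expOf_succ hU kindSeries_free m)
    (fun m => by simpa using coeff_X_mul_expOf_succ hUW kindSeries_pending m)
    (fun m => by simpa using coeff_X_mul_expOf_succ hUFW kindSeries_pending_add_tight m)
    (fun m => by
      conv_lhs => rw [kindSeries_used]
      exact coeff_mul_add_two hF hP m)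
  refine List.map_injective_iff.2 (Nat.cast_injective (R := ℚ)) ?_
  rw [List.map_map]
  refine Eq.trans (List.map_congr_left fun i _ => ?_) (key.trans (by norm_num))
  simp only [Function.comp_apply, hval, map_add]
  ring

end TreeVertexCovers

theorem theorem3 :
    (∃! U : PowerSeries ℚ, TreeVertexCovers.IsImplicitSolution U) ∧
    (∀ U : PowerSeries ℚ, TreeVertexCovers.IsImplicitSolution U →
      TreeVertexCovers.vcSeries =
        (1 - U) * PowerSeries.X * TreeVertexCovers.expOf U
          - U * TreeVertexCovers.treeOf (PowerSeries.X ^ 2 * TreeVertexCovers.expOf (2 * U))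
          + U - (1 / 2 : ℚ) • U ^ 2) ∧
    (List.range 10).map (fun i => TreeVertexCovers.numMinVertexCovers (i + 1)) =
      [1, 2, 3, 40, 185, 3936, 35917, 978160, 14301513, 464105440] := by
  have h := TreeVertexCovers.isImplicitSolution_kindSeries
  refine ⟨⟨_, h, fun V hV => hV.eq h⟩, fun U hU => ?_, TreeVertexCovers.map_numMinVertexCovers⟩
  rw [hU.eq h]
  exact TreeVertexCovers.vcSeries_eq
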